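/- Let $0<p_B<p_A<1$ and $g>0$, and put $r_A=(1-p_A)/p_A$. For a continuously differentiable function $f$ with compact support in $[0,\infty)$ let $$Lf(y)=p_B\,y\,\frac{f(y+g)-f(y)}{g}+(1-p_A-p_A\,y)\,f'(y),\qquad y\ge 0 .$$ A Markov process on $[0,\infty)$ with generator $L$ is given by a semigroup of Markov kernels $(P_t)_{t\ge 0}$ on $[0,\infty)$ (so $P_0=\mathrm{Id}$ and $P_{s+t}=P_sP_t$) such that $(P_tf-f)/t\to Lf$ uniformly on $[0,\infty)$ as $t\downarrow 0$, for every such $f$; write $\mathbb E_y f(Y_t)=\int f(z)\,P_t(y,dz)$. There is exactly one such semigroup. The Markov process $(Y_t)_{t\ge0}$ with generator $L$ has a unique stationary probability distribution $\nu$, and for every compact $K\subset[0,\infty)$ and every bounded continuous $f:[0,\infty)\to\mathbb R$, $$\lim_{t\to\infty}\ \sup_{y\in K}\Big|\mathbb E_y f(Y_t)-\int f\,d\nu\Big|=0 .$$ Moreover $\nu$ has a density on $[0,\infty)$ which vanishes on $(0,r_A]$, is positive and continuous on the open interval $(r_A,\infty)$, and is $C^\infty$ away from the points $r_A+ng$,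 $n\in\{0,1,2,\dots\}$. -/

import Mathlib

open MeasureTheory ProbabilityTheory Filter Topology
open scoped NNReal ENNReal BoundedContinuousFunction ContDiff

namespace Bandit

/-- The operator
`L f (y) = pB * y * (f (y + g) - f y) / g + (1 - pA - pA * y) * f' y`, for `y ≥ 0`.
A continuously differentiable function with compact support in `[0, ∞)` is represented by a
continuously differentiable compactly supported function on `ℝ`, of which only the values on
`[0, ∞)` matter; the derivative at `0` is then the right derivative. -/
noncomputable def generatorL (pA pB g : ℝ) (f : ℝ → ℝ) (y : ℝ≥0) : ℝ :=
  pB * y * ((f (y + g) - f y) / g) + (1 - pA - pA * y) * deriv f y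

/-- `P` is the transition semigroup of a (time-homogeneous, conservative) Markov process on
`[0, ∞)`: `P t y` is the law of `Y_t` for the process started at `y`, so that
`E_y f(Y_t) = ∫ z, f z ∂(P t y)`. -/
structure IsTransitionSemigroup (P : ℝ≥0 → Kernel ℝ≥0 ℝ≥0) : Prop where
  isMarkov : ∀ t, IsMarkovKernel (P t)
  zero : P 0 = Kernel.id
  add : ∀ s t, P (s + t) = P t ∘ₖ P s

/-- `P` is the transition semigroup of a Markov process on `[0, ∞)` with generator `L`: for every
`C¹` function `f` with compact support, `(E_y f(Y_t) - f(y)) / t → L f (y)` as `t ↓ 0`,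
uniformly in `y ∈ [0, ∞)`. -/
structure IsMarkovSemigroupWithGeneratorL (pA pB g : ℝ) (P : ℝ≥0 → Kernel ℝ≥0 ℝ≥0) : Prop
    extends IsTransitionSemigroup P where
  generator : ∀ f : ℝ → ℝ, ContDiff ℝ 1 f → HasCompactSupport f →
    TendstoUniformly
      (fun (t : ℝ≥0) (y : ℝ≥0) => ((∫ z, f z ∂(P t y)) - f y) / (t : ℝ))
      (generatorL pA pB g f) (𝓝[>] 0)

/-- `ν` is a stationary probability distribution of the semigroup `P`. -/
def IsStationary (P : ℝ≥0 → Kernel ℝ≥0 ℝ≥0) (ν : Measure ℝ≥0) : Prop :=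
  IsProbabilityMeasure ν ∧ ∀ t, Kernel.Invariant (P t) ν

end Bandit

/-!
The process jumps from `y` to `y + g` at rate `pB y / g` and otherwise follows
`y' = 1 - pA - pA y`, so the generator is affine in `y` and maps exponentials to exponentials times
affine functions: `L exp (-u ·) (y) = (y R(u) - (1 - pA) u) exp (-u y)`, with the branching
mechanism `R(u) = pA u - (pB / g) (1 - exp (-g u))`. Hence the Laplace transforms of the process are
explicit, `E_y exp (-θ Y_t) = exp (-B(θ) + B(ψ) - ψ y)`, where `ψ = ψ(t, θ)` is the flow of `-R` and
`B'(u) = (1 - pA) u / R(u)` (`laplaceSol`). Finite measures on `[0, ∞)` are determined by their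
Laplace transforms (`ext_of_laplace`), and almost everything is read off from these.

*Uniqueness.* The generator of a semigroup in the sense of uniform convergence is closed
(`IsGen.of_approx`), so that it is known on exponentials, which are limits of smooth truncations.
Then `s ↦ Q_{T - s} (laplaceSol θ s)` is constant (`IsTransitionSemigroup.integral_eq_of_backward`),
and the Laplace transform of any semigroup with generator `L` is `laplaceSol`.

*Existence.* The law of the process is the sum over `n` of the laws on the event of having exactly
`n` jumps, obtained by iterating the kernel of the first jump (`transitionKernel`). It is the minimal
solution of the first-jump equation, which `laplaceSol` also solves. The two agree because every jump
multiplies the bound `exp (-θ exp (-pA t) y)` by `exp (-θ exp (-pA t) g)`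
(`lintegral_exp_transitionKernel`). Non-explosion and the semigroup property follow from the formula.
The generator is right on exponentials, and hence on `C¹` functions with compact support by a
weighted Weierstrass approximation in the variable `exp (-y)` (`isGen_of_exp`).

*Convergence.* Since `pB < pA`, `ψ(t, θ) → 0` as `t → ∞`, so the Laplace transforms converge to
`exp (-B(θ))`, uniformly over bounded sets of initial points, and the laws are tight. Prokhorov's
theorem provides the limit `ν`, and the continuity theorem the convergence.

*Density.* The Laplace transform `exp (-B)` satisfies
`R(θ) ∫ z exp (-θ z) dν = (1 - pA) θ ∫ exp (-θ z) dν`; dividing by `θ` and inverting gives the flux equation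
`pA (x - r) ν(dx) = (pB / g) (∫ z in [x - g, x], z ν(dz)) dx` with `r = (1 - pA) / pA`
(`isFluxMeasure_of_laplace_eq`). Signs force `ν` to live on `[r, ∞)`; an atom at `r` would produce a
density of order `1 / (x - r)`, which is not integrable; so `ν` has a density `φ` with
`φ(x) = κ (∫ z in x - g..x, z φ(z)) / (x - r)` for `x > r`. Continuity, positivity and, by
bootstrapping, smoothness off the points `r + g n` are consequences of this equation
(`IsFluxSolution`).
-/

namespace Bandit

/-! ### Laplace transforms of measures on the half-line -/

lemma measurable_exp_neg_mul (θ : ℝ) : Measurable fun z : ℝ≥0 => Real.exp (-(θ * z)) := by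
  fun_prop

lemma integrable_exp_neg_mul (μ : Measure ℝ≥0) [IsFiniteMeasure μ] {θ : ℝ} (hθ : 0 ≤ θ) :
    Integrable (fun z : ℝ≥0 => Real.exp (-(θ * z))) μ := by
  refine Integrable.of_bound (measurable_exp_neg_mul θ).aestronglyMeasurable 1 (ae_of_all _ ?_)
  intro z
  rw [Real.norm_eq_abs, Real.abs_exp, Real.exp_le_one_iff]
  have := mul_nonneg hθ z.2
  simpa using this

/-- The star subalgebra of bounded continuous functions on `[0, ∞)` which are polynomials in
`y ↦ exp (-y)`. -/
noncomputable def expPolynomials : StarSubalgebra ℝ (ℝ≥0 →ᵇ ℝ) where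
  carrier := {u | ∃ p : Polynomial ℝ, ∀ y : ℝ≥0, u y = p.eval (Real.exp (-(y : ℝ)))}
  mul_mem' := by
    rintro a b ⟨p, hp⟩ ⟨q, hq⟩
    exact ⟨p * q, fun y => by simp [hp, hq]⟩
  add_mem' := by
    rintro a b ⟨p, hp⟩ ⟨q, hq⟩
    exact ⟨p + q, fun y => by simp [hp, hq]⟩
  algebraMap_mem' := fun c => ⟨Polynomial.C c, fun y => by simp⟩
  star_mem' := by
    rintro a ⟨p, hp⟩
    exact ⟨p, fun y => by simpa using hp y⟩

lemma expPolynomials_separatesPoints :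
    (expPolynomials.map (BoundedContinuousFunction.toContinuousMapStarₐ ℝ)).SeparatesPoints := by
  intro x y hxy
  let u : ℝ≥0 →ᵇ ℝ := BoundedContinuousFunction.ofNormedAddCommGroup
    (fun z : ℝ≥0 => Real.exp (-(z : ℝ))) (by fun_prop) 1 (fun z => by
      rw [Real.norm_eq_abs, Real.abs_exp, Real.exp_le_one_iff]; simp)
  refine ⟨fun z => u z, ⟨BoundedContinuousFunction.toContinuousMapStarₐ ℝ u, ?_, rfl⟩, ?_⟩
  · exact ⟨u, ⟨Polynomial.X, fun z => by simp [u]⟩, rfl⟩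
  · intro h
    apply hxy
    have h' : Real.exp (-(x : ℝ)) = Real.exp (-(y : ℝ)) := h
    rw [Real.exp_eq_exp] at h'
    exact NNReal.coe_injective (neg_injective h')

lemma integral_expPolynomial (μ : Measure ℝ≥0) [IsFiniteMeasure μ] (p : Polynomial ℝ) :
    ∫ y : ℝ≥0, p.eval (Real.exp (-(y : ℝ))) ∂μ =
      ∑ n ∈ p.support, p.coeff n * ∫ y : ℝ≥0, Real.exp (-((n : ℝ) * y)) ∂μ := by
  simp_rw [Polynomial.eval_eq_sum, Polynomial.sum]
  rw [integral_finsetSum]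
  · refine Finset.sum_congr rfl fun n _ => ?_
    rw [← integral_const_mul]
    congr 1
    ext y
    rw [← Real.exp_nat_mul]
    congr 2
    ring
  · intro n _
    have := (integrable_exp_neg_mul μ (Nat.cast_nonneg n)).const_mul (p.coeff n)
    refine this.congr (ae_of_all _ fun y => ?_)
    simp only
    rw [← Real.exp_nat_mul]
    congr 2
    ring

/-- As `θ ↓ 0` the Laplace transform of a finite measure tends to its total mass. -/
lemma tendsto_laplace_zero (μ : Measure ℝ≥0) [IsFiniteMeasure μ] :
    Tendsto (fun θ : ℝ => ∫ y : ℝ≥0, Real.exp (-(θ * y)) ∂μ) (𝓝[>] 0) (𝓝 (μ.real Set.univ)) := by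
  have h1 : μ.real Set.univ = ∫ y : ℝ≥0, (1 : ℝ) ∂μ := by simp
  rw [h1]
  refine tendsto_integral_filter_of_dominated_convergence (fun _ => 1) ?_ ?_
    (integrable_const _) ?_
  · exact Eventually.of_forall fun θ => (measurable_exp_neg_mul θ).aestronglyMeasurable
  · filter_upwards [self_mem_nhdsWithin] with θ hθ
    refine ae_of_all _ fun z => ?_
    rw [Real.norm_eq_abs, Real.abs_exp, Real.exp_le_one_iff]
    have := mul_nonneg (le_of_lt hθ) z.2
    simpa using this
  · refine ae_of_all _ fun z => ?_
    have : Continuous fun θ : ℝ => Real.exp (-(θ * z)) := by fun_prop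
    simpa using (this.tendsto 0).mono_left nhdsWithin_le_nhds

/-- Finite measures on `[0, ∞)` are determined by their Laplace transforms on `(0, ∞)`. -/
lemma ext_of_laplace {μ ν : Measure ℝ≥0} [IsFiniteMeasure μ] [IsFiniteMeasure ν]
    (h : ∀ θ : ℝ, 0 < θ →
      ∫ y : ℝ≥0, Real.exp (-(θ * y)) ∂μ = ∫ y : ℝ≥0, Real.exp (-(θ * y)) ∂ν) : μ = ν := by
  refine ext_of_forall_mem_subalgebra_integral_eq_of_polish expPolynomials_separatesPoints ?_
  rintro u ⟨p, hp⟩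
  simp_rw [hp]
  rw [integral_expPolynomial, integral_expPolynomial]
  refine Finset.sum_congr rfl fun n _ => ?_
  congr 1
  rcases Nat.eq_zero_or_pos n with rfl | hn
  · have h0 := tendsto_nhds_unique ((tendsto_laplace_zero μ).congr' ?_) (tendsto_laplace_zero ν)
    · simpa using h0
    · filter_upwards [self_mem_nhdsWithin] with θ hθ using h θ hθ
  · exact h n (by exact_mod_cast hn)

/-- A uniform lower bound, tending to `1` at `0`, for the Laplace transforms of a family of
probability measures on `[0, ∞)` makes the family tight. -/
lemma isTightMeasureSet_of_laplace {ι : Type*} {μ : ι → Measure ℝ≥0}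
    [∀ i, IsProbabilityMeasure (μ i)] {b : ℝ → ℝ} (hb : Tendsto b (𝓝[>] 0) (𝓝 1))
    (h : ∀ i, ∀ θ : ℝ, 0 < θ → b θ ≤ ∫ y : ℝ≥0, Real.exp (-(θ * y)) ∂(μ i)) :
    IsTightMeasureSet {μ i | i} := by
  rw [isTightMeasureSet_iff_exists_isCompact_measure_compl_le]
  intro ε hε
  wlog hε1 : ε ≠ ⊤ generalizing ε
  · obtain ⟨K, hK, hK'⟩ := this 1 one_pos ENNReal.one_ne_top
    refine ⟨K, hK, fun m hm => (hK' m hm).trans ?_⟩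
    rw [not_not] at hε1
    simp [hε1]
  set e := ε.toReal with he
  have he0 : 0 < e := ENNReal.toReal_pos hε.ne' hε1
  have hb' : ∀ᶠ θ in 𝓝[>] (0 : ℝ), 1 - e / 2 < b θ := hb.eventually (lt_mem_nhds (by linarith))
  obtain ⟨θ, hbθ, hθ⟩ := (hb'.and self_mem_nhdsWithin).exists
  have hθ : 0 < θ := hθ
  refine ⟨Set.Icc 0 (1 / θ).toNNReal, isCompact_Icc, ?_⟩
  rintro _ ⟨i, rfl⟩
  have hI := integrable_exp_neg_mul (μ i) hθ.le
  set K : Set ℝ≥0 := Set.Icc 0 (1 / θ).toNNReal with hK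
  have hKm : MeasurableSet Kᶜ := measurableSet_Icc.compl
  -- `1 - exp (-θ y)` is nonnegative, and at least `1/2` outside of `[0, 1/θ]`
  have hpt : ∀ y : ℝ≥0, Kᶜ.indicator (fun _ => (1 / 2 : ℝ)) y ≤ 1 - Real.exp (-(θ * y)) := by
    intro y
    by_cases hy : y ∈ Kᶜ
    · rw [Set.indicator_of_mem hy]
      have h1 : (1 / θ).toNNReal < y := by
        by_contra hcon
        exact hy ⟨zero_le, not_lt.mp hcon⟩
      have h2 : 1 / θ < y := by
        rw [← NNReal.coe_lt_coe, Real.coe_toNNReal _ (by positivity)] at h1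
        exact h1
      have h3 : 1 < θ * y := by
        rw [div_lt_iff₀ hθ] at h2
        linarith
      have h4 : Real.exp (-(θ * y)) ≤ Real.exp (-1) := Real.exp_le_exp.mpr (by linarith)
      have h5 := Real.exp_neg_one_lt_half
      linarith
    · rw [Set.indicator_of_notMem hy]
      have := mul_nonneg hθ.le y.2
      have : Real.exp (-(θ * y)) ≤ 1 := Real.exp_le_one_iff.mpr (by linarith! [this])
      linarith
  have hint : ∫ y, Kᶜ.indicator (fun _ => (1 / 2 : ℝ)) y ∂(μ i) ≤
      ∫ y : ℝ≥0, (1 - Real.exp (-(θ * y))) ∂(μ i) :=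
    integral_mono ((integrable_const (1 / 2 : ℝ)).indicator hKm) ((integrable_const 1).sub hI) hpt
  rw [integral_indicator_const _ hKm, integral_sub (integrable_const 1) hI] at hint
  have h8 : (μ i).real Kᶜ ≤ e := by
    have := h i θ hθ
    simp only [smul_eq_mul, integral_const, probReal_univ, mul_one] at hint
    linarith
  rw [← ofReal_measureReal, ← ENNReal.ofReal_toReal hε1]
  exact ENNReal.ofReal_le_ofReal h8

/-- Continuity theorem for Laplace transforms of a tight family of probability measures. -/
lemma tendsto_of_laplace {ι : Type*} {l : Filter ι} {μ : ι → ProbabilityMeasure ℝ≥0}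
    {ν : ProbabilityMeasure ℝ≥0} (htight : IsTightMeasureSet {(μ i : Measure ℝ≥0) | i})
    (h : ∀ θ : ℝ, 0 < θ → Tendsto (fun i => ∫ y : ℝ≥0, Real.exp (-(θ * y)) ∂(μ i)) l
      (𝓝 (∫ y : ℝ≥0, Real.exp (-(θ * y)) ∂ν))) :
    Tendsto μ l (𝓝 ν) := by
  refine ProbabilityMeasure.tendsto_of_tight_of_separatesPoints ℝ htight
    expPolynomials_separatesPoints ?_
  rintro u ⟨p, hp⟩
  simp_rw [hp]
  simp_rw [integral_expPolynomial]
  refine tendsto_finsetSum _ fun n _ => Tendsto.const_mul _ ?_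
  rcases Nat.eq_zero_or_pos n with rfl | hn
  · simpa using tendsto_const_nhds
  · exact h n (by exact_mod_cast hn)

/-! ### The branching mechanism and its flow -/

/-- The standing assumptions on the parameters. -/
structure Admissible (pA pB g : ℝ) : Prop where
  pB_pos : 0 < pB
  lt : pB < pA
  lt_one : pA < 1
  g_pos : 0 < g

/-- The branching mechanism `R`: the generator maps `y ↦ exp (-u y)` to
`y ↦ (y R(u) - (1 - pA) u) exp (-u y)`. -/
noncomputable def branching (pA pB g u : ℝ) : ℝ := pA * u - pB / g * (1 - Real.exp (-(g * u)))

section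
variable {pA pB g : ℝ} (hp : Admissible pA pB g)
include hp

lemma Admissible.pA_pos : 0 < pA := hp.pB_pos.trans hp.lt

lemma le_branching (u : ℝ) : (pA - pB) * u ≤ branching pA pB g u := by
  have h1 := Real.add_one_le_exp (-(g * u))
  have h2 : pB / g * (1 - Real.exp (-(g * u))) ≤ pB / g * (g * u) :=
    mul_le_mul_of_nonneg_left (by linarith) (div_nonneg hp.pB_pos.le hp.g_pos.le)
  have h3 : pB / g * (g * u) = pB * u := by
    have := hp.g_pos.ne'
    field_simp
  unfold branching
  linarith

lemma branching_le {u : ℝ} (hu : 0 ≤ u) : branching pA pB g u ≤ pA * u := by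
  have h1 : Real.exp (-(g * u)) ≤ 1 :=
    Real.exp_le_one_iff.mpr (by have := mul_nonneg hp.g_pos.le hu; linarith)
  have h2 : 0 ≤ pB / g * (1 - Real.exp (-(g * u))) :=
    mul_nonneg (div_nonneg hp.pB_pos.le hp.g_pos.le) (by linarith)
  unfold branching
  linarith

lemma branching_pos {u : ℝ} (hu : 0 < u) : 0 < branching pA pB g u :=
  lt_of_lt_of_le (mul_pos (sub_pos.mpr hp.lt) hu) (le_branching hp u)

omit hp in
lemma continuous_branching : Continuous (branching pA pB g) := by
  unfold branching
  fun_prop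

lemma hasDerivAt_branching (u : ℝ) :
    HasDerivAt (branching pA pB g) (pA - pB * Real.exp (-(g * u))) u := by
  have h1 : HasDerivAt (fun u => Real.exp (-(g * u))) (Real.exp (-(g * u)) * (-(g * 1))) u :=
    (((hasDerivAt_id u).const_mul g).neg).exp
  have h2 := ((hasDerivAt_id u).const_mul pA).sub ((h1.const_sub 1).const_mul (pB / g))
  refine h2.congr_deriv ?_
  have := hp.g_pos.ne'
  field_simp

/-- `∫ w in 0..v, exp w / R (exp w)`: the time the flow of `-R` needs to go from `exp v` down
to `1`. -/
noncomputable def hitTime (pA pB g v : ℝ) : ℝ :=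
  ∫ w in (0 : ℝ)..v, Real.exp w / branching pA pB g (Real.exp w)

lemma hasDerivAt_hitTime (v : ℝ) : HasDerivAt (hitTime pA pB g)
    (Real.exp v / branching pA pB g (Real.exp v)) v := by
  have hc : Continuous fun w => Real.exp w / branching pA pB g (Real.exp w) :=
    Real.continuous_exp.div (continuous_branching.comp Real.continuous_exp)
      fun w => (branching_pos hp (Real.exp_pos w)).ne'
  exact intervalIntegral.integral_hasDerivAt_right (hc.intervalIntegrable _ _)
    (hc.stronglyMeasurableAtFilter _ _) hc.continuousAt

lemma monotone_hitTime_sub : Monotone fun v => hitTime pA pB g v - v / pA := by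
  have hd : ∀ v, HasDerivAt (fun v => hitTime pA pB g v - v / pA)
      (Real.exp v / branching pA pB g (Real.exp v) - 1 / pA) v := fun v =>
    (hasDerivAt_hitTime hp v).sub ((hasDerivAt_id v).div_const pA)
  refine monotone_of_deriv_nonneg (fun v => (hd v).differentiableAt) fun v => ?_
  rw [(hd v).deriv, sub_nonneg, div_le_div_iff₀ hp.pA_pos (branching_pos hp (Real.exp_pos v))]
  have := branching_le hp (Real.exp_pos v).le
  linarith

lemma strictMono_hitTime : StrictMono (hitTime pA pB g) := by
  intro a b hab
  have h1 := monotone_hitTime_sub hp hab.le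
  have h2 : a / pA < b / pA := div_lt_div_of_pos_right hab hp.pA_pos
  simp only at h1
  linarith

lemma surjective_hitTime : Function.Surjective (hitTime pA pB g) := by
  have hc : Continuous (hitTime pA pB g) :=
    continuous_iff_continuousAt.mpr fun v => (hasDerivAt_hitTime hp v).continuousAt
  have h0 : hitTime pA pB g 0 = 0 := by simp [hitTime]
  have hm := monotone_hitTime_sub hp
  refine hc.surjective ?_ ?_
  · refine tendsto_atTop_mono' _ ?_ (tendsto_id.atTop_div_const hp.pA_pos)
    filter_upwards [eventually_ge_atTop 0] with v hv
    have := hm hv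
    simp only [h0, zero_div, sub_zero, id] at this ⊢
    linarith
  · refine tendsto_atBot_mono' _ ?_ (tendsto_id.atBot_div_const hp.pA_pos)
    filter_upwards [eventually_le_atBot 0] with v hv
    have := hm hv
    simp only [h0, zero_div, sub_zero, id] at this ⊢
    linarith

/-- `hitTime` as an order isomorphism of the real line. -/
noncomputable def hitTimeIso : ℝ ≃o ℝ :=
  (strictMono_hitTime hp).orderIsoOfSurjective _ (surjective_hitTime hp)

/-- The flow `ψ` of the differential equation `∂ₜ ψ = - R(ψ)` on `(0, ∞)`, at time `t` (of either
sign) and started at `θ`. -/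
noncomputable def psi (t θ : ℝ) : ℝ :=
  Real.exp ((hitTimeIso hp).symm (hitTimeIso hp (Real.log θ) - t))

lemma psi_pos (t θ : ℝ) : 0 < psi hp t θ := Real.exp_pos _

lemma psi_zero {θ : ℝ} (hθ : 0 < θ) : psi hp 0 θ = θ := by
  simp [psi, Real.exp_log hθ]

lemma psi_add (s t θ : ℝ) : psi hp (s + t) θ = psi hp s (psi hp t θ) := by
  simp only [psi, Real.log_exp, OrderIso.apply_symm_apply]
  congr 2
  ring

lemma hasDerivAt_psi (t θ : ℝ) :
    HasDerivAt (fun t => psi hp t θ) (-branching pA pB g (psi hp t θ)) t := by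
  set e := hitTimeIso hp with he
  set x := e (Real.log θ) - t with hx
  have h1 : HasDerivAt e (Real.exp (e.symm x) / branching pA pB g (Real.exp (e.symm x)))
      (e.symm x) := hasDerivAt_hitTime hp _
  have hne := (branching_pos hp (Real.exp_pos (e.symm x))).ne'
  have h2 : HasDerivAt e.symm
      (Real.exp (e.symm x) / branching pA pB g (Real.exp (e.symm x)))⁻¹ x :=
    h1.of_local_left_inverse e.symm.continuous.continuousAt
      (div_ne_zero (Real.exp_pos _).ne' hne) (Eventually.of_forall e.apply_symm_apply)
  have h3 : HasDerivAt (fun t => e (Real.log θ) - t) (-1) t := (hasDerivAt_id t).const_sub _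
  refine ((h2.comp t h3).exp).congr_deriv ?_
  have h4 : psi hp t θ = Real.exp (e.symm x) := rfl
  rw [h4]
  have := (Real.exp_pos (e.symm x)).ne'
  simp only [Function.comp, ← hx, ← he]
  field_simp

lemma le_psi {t θ : ℝ} (ht : 0 ≤ t) (hθ : 0 < θ) : θ * Real.exp (-(pA * t)) ≤ psi hp t θ := by
  have hd : ∀ s, HasDerivAt (fun s => psi hp s θ * Real.exp (pA * s))
      (-branching pA pB g (psi hp s θ) * Real.exp (pA * s)
        + psi hp s θ * (Real.exp (pA * s) * (pA * 1))) s := fun s =>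
    (hasDerivAt_psi hp s θ).mul (((hasDerivAt_id s).const_mul pA).exp)
  have hm : Monotone fun s => psi hp s θ * Real.exp (pA * s) := by
    refine monotone_of_deriv_nonneg (fun s => (hd s).differentiableAt) fun s => ?_
    rw [(hd s).deriv]
    have := mul_le_mul_of_nonneg_right (branching_le hp (psi_pos hp s θ).le)
      (Real.exp_pos (pA * s)).le
    linarith
  have := hm ht
  simp only [mul_zero, Real.exp_zero, mul_one, psi_zero hp hθ] at this
  rw [Real.exp_neg, ← div_eq_mul_inv, div_le_iff₀ (Real.exp_pos _)]
  exact this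

lemma psi_le {t θ : ℝ} (ht : 0 ≤ t) (hθ : 0 < θ) :
    psi hp t θ ≤ θ * Real.exp (-((pA - pB) * t)) := by
  have hd : ∀ s, HasDerivAt (fun s => psi hp s θ * Real.exp ((pA - pB) * s))
      (-branching pA pB g (psi hp s θ) * Real.exp ((pA - pB) * s)
        + psi hp s θ * (Real.exp ((pA - pB) * s) * ((pA - pB) * 1))) s := fun s =>
    (hasDerivAt_psi hp s θ).mul (((hasDerivAt_id s).const_mul (pA - pB)).exp)
  have hm : Antitone fun s => psi hp s θ * Real.exp ((pA - pB) * s) := by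
    refine antitone_of_deriv_nonpos (fun s => (hd s).differentiableAt) fun s => ?_
    rw [(hd s).deriv]
    have := mul_le_mul_of_nonneg_right (le_branching hp (psi hp s θ))
      (Real.exp_pos ((pA - pB) * s)).le
    linarith
  have := hm ht
  simp only [mul_zero, Real.exp_zero, mul_one, psi_zero hp hθ] at this
  rw [Real.exp_neg, ← div_eq_mul_inv, le_div_iff₀ (Real.exp_pos _)]
  exact this

lemma psi_le_self {t θ : ℝ} (ht : 0 ≤ t) (hθ : 0 < θ) : psi hp t θ ≤ θ := by
  refine (psi_le hp ht hθ).trans (mul_le_of_le_one_right hθ.le (Real.exp_le_one_iff.mpr ?_))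
  have := mul_nonneg (sub_pos.mpr hp.lt).le ht
  linarith

lemma tendsto_psi {θ : ℝ} (hθ : 0 < θ) : Tendsto (fun t => psi hp t θ) atTop (𝓝[>] 0) := by
  refine tendsto_nhdsWithin_iff.mpr ⟨?_, Eventually.of_forall fun t => psi_pos hp t θ⟩
  have h1 : Tendsto (fun t : ℝ => θ * Real.exp (-((pA - pB) * t))) atTop (𝓝 (θ * 0)) :=
    (Real.tendsto_exp_neg_atTop_nhds_zero.comp
      (tendsto_id.const_mul_atTop (sub_pos.mpr hp.lt))).const_mul θ
  rw [mul_zero] at h1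
  refine squeeze_zero' (Eventually.of_forall fun t => (psi_pos hp t θ).le) ?_ h1
  filter_upwards [eventually_ge_atTop 0] with t ht using psi_le hp ht hθ

omit hp in
/-- The immigration exponent `B(θ) = (1 - pA) ∫ u in 0..θ, u / R(u)`; the stationary distribution
turns out to have Laplace transform `exp (-B(θ))`. -/
noncomputable def immigration (pA pB g θ : ℝ) : ℝ :=
  (1 - pA) * ∫ u in (0 : ℝ)..θ, u / branching pA pB g u

lemma div_branching_le {u : ℝ} (hu : 0 < u) : u / branching pA pB g u ≤ 1 / (pA - pB) := by
  rw [div_le_div_iff₀ (branching_pos hp hu) (sub_pos.mpr hp.lt)]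
  linarith [le_branching hp u]

lemma intervalIntegrable_div_branching {θ : ℝ} (hθ : 0 ≤ θ) :
    IntervalIntegrable (fun u => u / branching pA pB g u) volume 0 θ := by
  rw [intervalIntegrable_iff_integrableOn_Ioc_of_le hθ]
  refine Measure.integrableOn_of_bounded (M := 1 / (pA - pB)) (by simp)
    (measurable_id.div continuous_branching.measurable).aestronglyMeasurable ?_
  filter_upwards [ae_restrict_mem measurableSet_Ioc] with u hu
  rw [Real.norm_of_nonneg (div_nonneg hu.1.le (branching_pos hp hu.1).le)]
  exact div_branching_le hp hu.1

lemma hasDerivAt_immigration {θ : ℝ} (hθ : 0 < θ) :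
    HasDerivAt (immigration pA pB g) ((1 - pA) * (θ / branching pA pB g θ)) θ := by
  refine HasDerivAt.const_mul _ (intervalIntegral.integral_hasDerivAt_right
    (intervalIntegrable_div_branching hp hθ.le) ?_ ?_)
  · exact (measurable_id.div continuous_branching.measurable).stronglyMeasurable
      |>.stronglyMeasurableAtFilter
  · exact continuousAt_id.div continuous_branching.continuousAt (branching_pos hp hθ).ne'

lemma immigration_nonneg {θ : ℝ} (hθ : 0 ≤ θ) : 0 ≤ immigration pA pB g θ := by
  refine mul_nonneg (by linarith [hp.lt_one]) (intervalIntegral.integral_nonneg hθ fun u hu => ?_)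
  rcases hu.1.eq_or_lt with rfl | h
  · simp
  · exact div_nonneg hu.1 (branching_pos hp h).le

lemma immigration_le {θ : ℝ} (hθ : 0 ≤ θ) :
    immigration pA pB g θ ≤ (1 - pA) / (pA - pB) * θ := by
  have h : ∫ u in (0 : ℝ)..θ, u / branching pA pB g u ≤ ∫ _ in (0 : ℝ)..θ, 1 / (pA - pB) := by
    refine intervalIntegral.integral_mono_on_of_le_Ioo hθ (intervalIntegrable_div_branching hp hθ)
      (by simp) fun u hu => div_branching_le hp hu.1
  rw [intervalIntegral.integral_const, smul_eq_mul, sub_zero] at h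
  have := mul_le_mul_of_nonneg_left h (by linarith [hp.lt_one] : (0 : ℝ) ≤ 1 - pA)
  unfold immigration
  refine this.trans (le_of_eq ?_)
  ring

lemma immigration_mono {a b : ℝ} (ha : 0 < a) (hab : a ≤ b) :
    immigration pA pB g a ≤ immigration pA pB g b := by
  have hm : MonotoneOn (immigration pA pB g) (Set.Ioi 0) := by
    refine monotoneOn_of_deriv_nonneg (convex_Ioi 0)
      (fun x hx => (hasDerivAt_immigration hp hx).continuousAt.continuousWithinAt) ?_ ?_
    · intro x hx
      rw [interior_Ioi] at hx
      exact (hasDerivAt_immigration hp hx).differentiableAt.differentiableWithinAt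
    · intro x hx
      rw [interior_Ioi] at hx
      rw [(hasDerivAt_immigration hp hx).deriv]
      exact mul_nonneg (by linarith [hp.lt_one]) (div_nonneg (le_of_lt hx) (branching_pos hp hx).le)
  exact hm ha (ha.trans_le hab : (0 : ℝ) < b) hab

lemma tendsto_immigration_zero : Tendsto (immigration pA pB g) (𝓝[>] 0) (𝓝 0) := by
  have h1 : Tendsto (fun θ : ℝ => (1 - pA) / (pA - pB) * θ) (𝓝[>] 0) (𝓝 0) := by
    have : Continuous fun θ : ℝ => (1 - pA) / (pA - pB) * θ := by fun_prop
    simpa using (this.tendsto 0).mono_left nhdsWithin_le_nhds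
  refine squeeze_zero' ?_ ?_ h1
  · filter_upwards [self_mem_nhdsWithin] with θ hθ using immigration_nonneg hp (le_of_lt hθ)
  · filter_upwards [self_mem_nhdsWithin] with θ hθ using immigration_le hp (le_of_lt hθ)

/-- The Laplace transform at `θ` of the law of the process at time `t` started at `y`. -/
noncomputable def laplaceSol (θ t y : ℝ) : ℝ :=
  Real.exp (-(immigration pA pB g θ) + immigration pA pB g (psi hp t θ) - psi hp t θ * y)

lemma laplaceSol_pos (θ t y : ℝ) : 0 < laplaceSol hp θ t y := Real.exp_pos _

lemma laplaceSol_zero {θ : ℝ} (hθ : 0 < θ) (y : ℝ) : laplaceSol hp θ 0 y = Real.exp (-(θ * y)) := by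
  simp [laplaceSol, psi_zero hp hθ]

lemma laplaceSol_le_exp {θ t y : ℝ} (hθ : 0 < θ) (ht : 0 ≤ t) :
    laplaceSol hp θ t y ≤ Real.exp (-(psi hp t θ * y)) := by
  have := immigration_mono hp (psi_pos hp t θ) (psi_le_self hp ht hθ)
  exact Real.exp_le_exp.mpr (by linarith)

/-- The semigroup property on the level of Laplace transforms. -/
lemma laplaceSol_add (θ s t y : ℝ) :
    laplaceSol hp θ (t + s) y =
      Real.exp (-(immigration pA pB g θ) + immigration pA pB g (psi hp s θ)) *
        laplaceSol hp (psi hp s θ) t y := by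
  rw [laplaceSol, laplaceSol, ← Real.exp_add, psi_add]
  congr 1
  ring

end

/-! ### Semigroups of Markov kernels and their generators -/

/-- `f` is a bounded measurable function on which the generator of `Q` (in the sense of uniform
convergence) is defined, with value `Lf`. -/
structure IsGen (Q : ℝ≥0 → Kernel ℝ≥0 ℝ≥0) (f Lf : ℝ≥0 → ℝ) : Prop where
  measurable : Measurable f
  bounded : ∃ C, ∀ y, |f y| ≤ C
  tendsto : TendstoUniformly (fun (t : ℝ≥0) y => ((∫ z, f z ∂(Q t y)) - f y) / (t : ℝ)) Lf (𝓝[>] 0)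

lemma integrable_of_bounded {μ : Measure ℝ≥0} [IsFiniteMeasure μ] {f : ℝ≥0 → ℝ}
    (hf : Measurable f) (hb : ∃ C, ∀ y, |f y| ≤ C) : Integrable f μ := by
  obtain ⟨C, hC⟩ := hb
  exact Integrable.of_bound hf.aestronglyMeasurable C (ae_of_all _ hC)

lemma abs_integral_le_of_bounded {μ : Measure ℝ≥0} [IsProbabilityMeasure μ] {f : ℝ≥0 → ℝ}
    {C : ℝ} (hC : ∀ y, |f y| ≤ C) : |∫ z, f z ∂μ| ≤ C := by
  have := norm_integral_le_of_norm_le_const (μ := μ) (f := f) (ae_of_all _ hC)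
  simpa using this

section
variable {Q : ℝ≥0 → Kernel ℝ≥0 ℝ≥0}

lemma IsGen.add {f₁ f₂ g₁ g₂ : ℝ≥0 → ℝ} (hQ : ∀ t, IsMarkovKernel (Q t))
    (h₁ : IsGen Q f₁ g₁) (h₂ : IsGen Q f₂ g₂) :
    IsGen Q (fun y => f₁ y + f₂ y) (fun y => g₁ y + g₂ y) := by
  obtain ⟨C₁, hC₁⟩ := h₁.bounded
  obtain ⟨C₂, hC₂⟩ := h₂.bounded
  refine ⟨h₁.measurable.add h₂.measurable,
    ⟨C₁ + C₂, fun y => (abs_add_le _ _).trans (add_le_add (hC₁ y) (hC₂ y))⟩, ?_⟩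
  convert h₁.tendsto.add h₂.tendsto using 1
  · ext t y
    simp only [Pi.add_apply]
    rw [integral_add (integrable_of_bounded h₁.measurable h₁.bounded)
      (integrable_of_bounded h₂.measurable h₂.bounded)]
    ring
  · rfl

lemma IsGen.const_mul {f Lf : ℝ≥0 → ℝ} (h : IsGen Q f Lf) (c : ℝ) :
    IsGen Q (fun y => c * f y) (fun y => c * Lf y) := by
  obtain ⟨C, hC⟩ := h.bounded
  refine ⟨h.measurable.const_mul c, ⟨|c| * C, fun y => ?_⟩, ?_⟩
  · rw [abs_mul]
    exact mul_le_mul_of_nonneg_left (hC y) (abs_nonneg c)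
  · have hu : UniformContinuous fun x : ℝ => c * x :=  uniformContinuous_mul_left' c
    convert hu.comp_tendstoUniformly h.tendsto using 1
    · ext t y
      simp only [Function.comp]
      rw [integral_const_mul]
      ring
    · rfl

lemma IsGen.sub {f₁ f₂ g₁ g₂ : ℝ≥0 → ℝ} (hQ : ∀ t, IsMarkovKernel (Q t))
    (h₁ : IsGen Q f₁ g₁) (h₂ : IsGen Q f₂ g₂) :
    IsGen Q (fun y => f₁ y - f₂ y) (fun y => g₁ y - g₂ y) := by
  simpa [sub_eq_add_neg] using h₁.add hQ (h₂.const_mul (-1))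

lemma isGen_zero : IsGen Q (fun _ => 0) (fun _ => 0) := by
  refine ⟨measurable_const, ⟨0, fun y => by simp⟩, ?_⟩
  simp only [integral_zero, sub_self, zero_div]
  intro u hu
  exact Eventually.of_forall fun _ _ => refl_mem_uniformity hu

lemma IsGen.sum {ι : Type*} (s : Finset ι) {f Lf : ι → ℝ≥0 → ℝ} (hQ : ∀ t, IsMarkovKernel (Q t))
    (h : ∀ i ∈ s, IsGen Q (f i) (Lf i)) :
    IsGen Q (fun y => ∑ i ∈ s, f i y) (fun y => ∑ i ∈ s, Lf i y) := by
  classical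
  induction s using Finset.induction_on with
  | empty => simpa using isGen_zero
  | insert a s ha ih =>
    simp only [Finset.sum_insert ha]
    exact (h a (Finset.mem_insert_self a s)).add hQ
      (ih fun i hi => h i (Finset.mem_insert_of_mem hi))

lemma measurable_integral_kernel (κ : Kernel ℝ≥0 ℝ≥0) {f : ℝ≥0 → ℝ} (hf : Measurable f) :
    Measurable fun y => ∫ z, f z ∂(κ y) :=
  (hf.stronglyMeasurable.integral_kernel).measurable

lemma IsTransitionSemigroup.integral_add (hQ : IsTransitionSemigroup Q) {f : ℝ≥0 → ℝ}
    (hf : Measurable f) (hb : ∃ C, ∀ y, |f y| ≤ C) (s t : ℝ≥0) (y : ℝ≥0) :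
    ∫ z, f z ∂(Q (s + t) y) = ∫ x, ∫ z, f z ∂(Q t x) ∂(Q s y) := by
  have := hQ.isMarkov (s + t)
  have hi : Integrable f ((Q t ∘ₖ Q s) y) := by
    rw [← hQ.add]
    exact integrable_of_bounded hf hb
  rw [hQ.add, Kernel.integral_comp hi]

/-- The generator controls the semigroup for all times: `|Q_t f - f| ≤ t * sup |Lf|`. -/
lemma IsGen.abs_sub_le (hQ : IsTransitionSemigroup Q) {f Lf : ℝ≥0 → ℝ} (h : IsGen Q f Lf) {c : ℝ}
    (hc : ∀ y, |Lf y| ≤ c) (t y : ℝ≥0) : |(∫ z, f z ∂(Q t y)) - f y| ≤ t * c := by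
  have hM := hQ.isMarkov
  have hfi : ∀ t y, Integrable f (Q t y) := fun t y => integrable_of_bounded h.measurable h.bounded
  obtain ⟨C, hC⟩ := h.bounded
  rcases eq_or_ne t 0 with rfl | ht
  · rw [hQ.zero, Kernel.id_apply, integral_dirac' _ _ h.measurable.stronglyMeasurable]
    simp
  refine le_of_forall_pos_le_add fun ε hε => ?_
  have ht0 : (0 : ℝ) < t := by exact_mod_cast pos_iff_ne_zero.mpr ht
  have h1 := Metric.tendstoUniformly_iff.mp h.tendsto (ε / t) (div_pos hε ht0)
  have h2 : Tendsto (fun n : ℕ => t / (n + 1 : ℕ)) atTop (𝓝[>] 0) := by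
    refine tendsto_nhdsWithin_iff.mpr ⟨?_, Eventually.of_forall fun n => ?_⟩
    · have := (tendsto_const_div_atTop_nhds_zero_nat (t : ℝ)).comp (tendsto_add_atTop_nat 1)
      rw [← NNReal.tendsto_coe]
      simpa [Function.comp_def] using this
    · exact div_pos (pos_iff_ne_zero.mpr ht) (by positivity)
  obtain ⟨n, hn⟩ := (h2.eventually h1).exists
  set s : ℝ≥0 := t / (n + 1 : ℕ) with hs
  have hs0 : (0 : ℝ) < s := by
    rw [hs]; push_cast; positivity
  have hstep : ∀ z, |(∫ x, f x ∂(Q s z)) - f z| ≤ s * (c + ε / t) := by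
    intro z
    have h3 := hn z
    rw [Real.dist_eq] at h3
    have h4 : |((∫ x, f x ∂(Q s z)) - f z) / (s : ℝ)| ≤ c + ε / t := by
      have h5 := abs_sub_abs_le_abs_sub (((∫ x, f x ∂(Q s z)) - f z) / (s : ℝ)) (Lf z)
      rw [abs_sub_comm] at h5
      linarith [hc z]
    rwa [abs_div, abs_of_pos hs0, div_le_iff₀ hs0, mul_comm] at h4
  -- telescoping over the steps of length `s`
  have hind : ∀ k : ℕ, |(∫ x, f x ∂(Q (k * s) y)) - f y| ≤ k * (s * (c + ε / t)) := by
    intro k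
    induction k with
    | zero =>
      simp only [Nat.cast_zero, zero_mul]
      rw [hQ.zero, Kernel.id_apply, integral_dirac' _ _ h.measurable.stronglyMeasurable]
      simp
    | succ k ih =>
      have h6 : ((k + 1 : ℕ) : ℝ≥0) * s = k * s + s := by push_cast; ring
      rw [h6, hQ.integral_add h.measurable h.bounded]
      have h7 : Integrable (fun x => ∫ z, f z ∂(Q s x)) (Q (k * s) y) :=
        integrable_of_bounded (measurable_integral_kernel _ h.measurable)
          ⟨C, fun x => abs_integral_le_of_bounded hC⟩
      have h8 : (∫ x, ∫ z, f z ∂(Q s x) ∂(Q (k * s) y)) - f y =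
          (∫ x, ((∫ z, f z ∂(Q s x)) - f x) ∂(Q (k * s) y)) + ((∫ x, f x ∂(Q (k * s) y)) - f y) := by
        rw [integral_sub h7 (hfi _ _)]
        ring
      rw [h8]
      refine (abs_add_le _ _).trans ?_
      have h9 : |∫ x, ((∫ z, f z ∂(Q s x)) - f x) ∂(Q (k * s) y)| ≤ s * (c + ε / t) :=
        abs_integral_le_of_bounded hstep
      push_cast
      linarith
  have h10 : ((n + 1 : ℕ) : ℝ≥0) * s = t := by
    rw [hs]
    field_simp
  have h11 := hind (n + 1)
  rw [h10] at h11
  refine h11.trans (le_of_eq ?_)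
  have h12 : ((n + 1 : ℕ) : ℝ) * s = t := by exact_mod_cast congrArg NNReal.toReal h10
  rw [← mul_assoc, h12]
  field_simp

/-- The generator is a closed operator. -/
lemma IsGen.of_approx (hQ : IsTransitionSemigroup Q) {f Lf : ℝ≥0 → ℝ} (hf : Measurable f)
    (hb : ∃ C, ∀ y, |f y| ≤ C)
    (h : ∀ ε > 0, ∃ f' Lf', IsGen Q f' Lf' ∧ (∀ y, |f y - f' y| ≤ ε) ∧ ∀ y, |Lf y - Lf' y| ≤ ε) :
    IsGen Q f Lf := by
  have hM := hQ.isMarkov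
  refine ⟨hf, hb, ?_⟩
  rw [Metric.tendstoUniformly_iff]
  intro ε hε
  obtain ⟨f₁, g₁, h₁, hf₁, hg₁⟩ := h (ε / 4) (by positivity)
  filter_upwards [Metric.tendstoUniformly_iff.mp h₁.tendsto (ε / 4) (by positivity),
    self_mem_nhdsWithin] with t ht ht0 y
  have ht0' : (0 : ℝ) < t := by exact_mod_cast ht0
  have hfi : ∀ y, Integrable f (Q t y) := fun y => integrable_of_bounded hf hb
  have hfi₁ : ∀ y, Integrable f₁ (Q t y) :=
    fun y => integrable_of_bounded h₁.measurable h₁.bounded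
  have hA : |((∫ z, f z ∂(Q t y)) - f y) - ((∫ z, f₁ z ∂(Q t y)) - f₁ y)| ≤ t * (ε / 4) := by
    refine le_of_forall_pos_le_add fun δ hδ => ?_
    obtain ⟨f₂, g₂, h₂, hf₂, hg₂⟩ := h (δ / (t + 2)) (by positivity)
    have hfi₂ : Integrable f₂ (Q t y) := integrable_of_bounded h₂.measurable h₂.bounded
    have hB := (h₂.sub hM h₁).abs_sub_le hQ (c := δ / (t + 2) + ε / 4) (fun z => by
      have h3 := hg₁ z
      have h4 := hg₂ z
      rw [abs_le] at h3 h4 ⊢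
      constructor <;> linarith) t y
    rw [integral_sub hfi₂ (hfi₁ y)] at hB
    have hC : |(∫ z, f z ∂(Q t y)) - ∫ z, f₂ z ∂(Q t y)| ≤ δ / (t + 2) := by
      rw [← integral_sub (hfi y) hfi₂]
      exact abs_integral_le_of_bounded hf₂
    have hD := hf₂ y
    have hE : t * (δ / (t + 2)) + 2 * (δ / (t + 2)) = δ := by field_simp
    rw [abs_le] at hB hC hD ⊢
    constructor <;> linarith
  have hA' : |((∫ z, f z ∂(Q t y)) - f y) / t - ((∫ z, f₁ z ∂(Q t y)) - f₁ y) / t| ≤ ε / 4 := by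
    rw [← sub_div, abs_div, abs_of_pos ht0', div_le_iff₀ ht0', mul_comm]
    exact hA
  have h5 := ht y
  have h6 := hg₁ y
  rw [Real.dist_eq] at h5 ⊢
  rw [abs_le] at hA' h6
  rw [abs_lt] at h5 ⊢
  constructor <;> linarith

/-- A solution `u` of the backward equation `∂ₛ u = L u` is given by the semigroup: the function
`s ↦ Q_{T - s} (u s)` has vanishing right derivative. -/
lemma IsTransitionSemigroup.integral_eq_of_backward (hQ : IsTransitionSemigroup Q)
    {u v : ℝ → ℝ≥0 → ℝ} {T : ℝ≥0} {C : ℝ}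
    (hgen : ∀ s ∈ Set.Icc (0 : ℝ) T, IsGen Q (u s) (v s))
    (hv : ∀ s ∈ Set.Icc (0 : ℝ) T, ∀ y, |v s y| ≤ C)
    (hlip : ∀ s ∈ Set.Icc (0 : ℝ) T, ∀ s' ∈ Set.Icc (0 : ℝ) T, s ≤ s' →
      ∀ y, |u s' y - u s y| ≤ C * (s' - s))
    (hder : ∀ s ∈ Set.Ico (0 : ℝ) T,
      TendstoUniformly (fun (h : ℝ≥0) y => (u (s + h) y - u s y) / (h : ℝ)) (v s) (𝓝[>] 0))
    (y : ℝ≥0) : ∫ z, u 0 z ∂(Q T y) = u T y := by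
  have hM := hQ.isMarkov
  set F : ℝ → ℝ := fun s => ∫ z, u s z ∂(Q (T - s).toNNReal y) with hF
  have hTs : ∀ s s' : ℝ, 0 ≤ s → s ≤ s' → s' ≤ T →
      (T - s).toNNReal = (T - s').toNNReal + (s' - s).toNNReal := by
    intro s s' hs hss hs'
    rw [← Real.toNNReal_add (by linarith) (by linarith)]
    congr 1
    ring
  -- the increment of `F` is controlled by one step of the semigroup
  have hinc : ∀ s s' : ℝ, 0 ≤ s → s ≤ s' → s' ≤ T → ∀ e : ℝ,
      (∀ z, |u s' z - ∫ x, u s x ∂(Q (s' - s).toNNReal z)| ≤ e) → |F s' - F s| ≤ e := by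
    intro s s' hs hss hs' e he
    have hg := hgen s ⟨hs, hss.trans hs'⟩
    have hg' := hgen s' ⟨hs.trans hss, hs'⟩
    obtain ⟨D, hD⟩ := hg.bounded
    have h1 : F s = ∫ z, ∫ x, u s x ∂(Q (s' - s).toNNReal z) ∂(Q (T - s').toNNReal y) := by
      simp only [hF]
      rw [hTs s s' hs hss hs', hQ.integral_add hg.measurable hg.bounded]
    rw [h1]
    simp only [hF]
    rw [← integral_sub (integrable_of_bounded hg'.measurable hg'.bounded)
      (integrable_of_bounded (measurable_integral_kernel _ hg.measurable)
        ⟨D, fun x => abs_integral_le_of_bounded hD⟩)]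
    exact abs_integral_le_of_bounded he
  have hFlip : ∀ s s' : ℝ, 0 ≤ s → s ≤ s' → s' ≤ T → |F s' - F s| ≤ 2 * C * (s' - s) := by
    intro s s' hs hss hs'
    refine hinc s s' hs hss hs' _ fun z => ?_
    have h1 := hlip s ⟨hs, hss.trans hs'⟩ s' ⟨hs.trans hss, hs'⟩ hss z
    have h2 := (hgen s ⟨hs, hss.trans hs'⟩).abs_sub_le hQ (hv s ⟨hs, hss.trans hs'⟩)
      (s' - s).toNNReal z
    rw [Real.coe_toNNReal _ (by linarith)] at h2
    rw [abs_le] at h1 h2 ⊢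
    constructor <;> linarith
  have hcont : ContinuousOn F (Set.Icc 0 T) := by
    have hC : 0 ≤ C := (abs_nonneg _).trans (hv 0 ⟨le_rfl, T.2⟩ 0)
    refine LipschitzOnWith.continuousOn (K := (2 * C).toNNReal)
      (LipschitzOnWith.of_dist_le_mul fun s hs s' hs' => ?_)
    rw [Real.coe_toNNReal _ (by linarith), Real.dist_eq, Real.dist_eq]
    rcases le_total s s' with h | h
    · rw [abs_sub_comm, abs_sub_comm s, abs_of_nonneg (sub_nonneg.mpr h)]
      exact hFlip s s' hs.1 h hs'.2
    · rw [abs_of_nonneg (sub_nonneg.mpr h)]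
      exact hFlip s' s hs'.1 h hs.2
  have hderiv : ∀ s ∈ Set.Ico (0 : ℝ) T, HasDerivWithinAt F 0 (Set.Ici s) s := by
    intro s hs
    rw [hasDerivWithinAt_iff_isLittleO, Asymptotics.isLittleO_iff]
    intro ε hε
    have h1 := Metric.tendstoUniformly_iff.mp (hgen s ⟨hs.1, hs.2.le⟩).tendsto (ε / 2)
      (by positivity)
    have h2 := Metric.tendstoUniformly_iff.mp (hder s hs) (ε / 2) (by positivity)
    have h3 : ∀ᶠ s' : ℝ in 𝓝[>] s, s' ≤ T ∧ ∀ z, |u s' z - ∫ x, u s x ∂(Q (s' - s).toNNReal z)| ≤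
        ε * (s' - s) := by
      have ht : Tendsto (fun s' : ℝ => (s' - s).toNNReal) (𝓝[>] s) (𝓝[>] 0) := by
        refine tendsto_nhdsWithin_iff.mpr ⟨?_, ?_⟩
        · have : Continuous fun s' : ℝ => (s' - s).toNNReal := by fun_prop
          simpa using (this.tendsto s).mono_left nhdsWithin_le_nhds
        · filter_upwards [self_mem_nhdsWithin] with s' hs'
          exact Real.toNNReal_pos.mpr (sub_pos.mpr hs')
      have hT : ∀ᶠ s' : ℝ in 𝓝[>] s, s' ≤ T :=
        (Ioo_mem_nhdsGT hs.2 |> mem_of_superset) fun x hx => hx.2.le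
      filter_upwards [ht.eventually h1, ht.eventually h2, self_mem_nhdsWithin, hT]
        with s' h1' h2' hs' hsT
      have hs'0 : 0 < s' - s := sub_pos.mpr hs'
      refine ⟨hsT, fun z => ?_⟩
      have h4 := h1' z
      have h5 := h2' z
      rw [Real.coe_toNNReal _ hs'0.le, Real.dist_eq] at h4 h5
      rw [add_sub_cancel] at h5
      have h6 : |(u s' z - u s z) / (s' - s) -
          ((∫ x, u s x ∂(Q (s' - s).toNNReal z)) - u s z) / (s' - s)| ≤ ε := by
        rw [abs_lt] at h4 h5
        rw [abs_le]
        constructor <;> linarith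
      rw [← sub_div, abs_div, abs_of_pos hs'0, div_le_iff₀ hs'0] at h6
      simpa using h6
    rw [← Set.Ioi_insert, nhdsWithin_insert]
    refine eventually_sup.mpr ⟨by simp, ?_⟩
    filter_upwards [h3, self_mem_nhdsWithin] with s' h4 hs'
    have hs'0 : 0 < s' - s := sub_pos.mpr hs'
    simp only [smul_zero, sub_zero, Real.norm_eq_abs]
    rw [abs_of_pos hs'0]
    exact hinc s s' hs.1 (le_of_lt hs') h4.1 _ h4.2
  have hconst := constant_of_has_deriv_right_zero hcont hderiv T ⟨T.2, le_rfl⟩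
  have h0 : F 0 = ∫ z, u 0 z ∂(Q T y) := by simp [hF]
  have hT : F T = u T y := by
    simp only [hF, sub_self, Real.toNNReal_zero]
    rw [hQ.zero, Kernel.id_apply,
      integral_dirac' _ _ (hgen T ⟨T.2, le_rfl⟩).measurable.stronglyMeasurable]
  rw [← h0, ← hT, hconst]

end

/-! ### Exponential functions in the domain of the generator -/

section
variable {pA pB g : ℝ} (hp : Admissible pA pB g)
include hp

/-- The time derivative of `laplaceSol`. -/
noncomputable def laplaceGen (θ t y : ℝ) : ℝ :=
  (y * branching pA pB g (psi hp t θ) - (1 - pA) * psi hp t θ) * laplaceSol hp θ t y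

lemma hasDerivAt_laplaceSol (θ t y : ℝ) :
    HasDerivAt (fun t => laplaceSol hp θ t y) (laplaceGen hp θ t y) t := by
  have h1 := hasDerivAt_psi hp t θ
  have h2 := (hasDerivAt_immigration hp (psi_pos hp t θ)).comp t h1
  refine (((h2.const_add (-(immigration pA pB g θ))).sub (h1.mul_const y)).exp).congr_deriv ?_
  have hne := (branching_pos hp (psi_pos hp t θ)).ne'
  simp only [laplaceGen, laplaceSol, Function.comp]
  rw [mul_comm]
  congr 1
  field_simp
  ring

lemma hasDerivAt_laplaceGen (θ t y : ℝ) :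
    HasDerivAt (fun t => laplaceGen hp θ t y)
      ((y * ((pA - pB * Real.exp (-(g * psi hp t θ))) * -branching pA pB g (psi hp t θ))
          - (1 - pA) * -branching pA pB g (psi hp t θ)) * laplaceSol hp θ t y
        + (y * branching pA pB g (psi hp t θ) - (1 - pA) * psi hp t θ) * laplaceGen hp θ t y) t := by
  have h1 := hasDerivAt_psi hp t θ
  have h2 := (hasDerivAt_branching hp (psi hp t θ)).comp t h1
  exact ((h2.const_mul y).sub (h1.const_mul (1 - pA))).mul (hasDerivAt_laplaceSol hp θ t y)

lemma generatorL_laplaceSol (θ t : ℝ) (y : ℝ≥0) :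
    generatorL pA pB g (laplaceSol hp θ t) y = laplaceGen hp θ t y := by
  have hd : HasDerivAt (laplaceSol hp θ t) (laplaceSol hp θ t y * (0 - psi hp t θ * 1)) y :=
    ((hasDerivAt_const (y : ℝ) (-(immigration pA pB g θ) + immigration pA pB g (psi hp t θ))).sub
      ((hasDerivAt_id (y : ℝ)).const_mul (psi hp t θ))).exp
  have hs : laplaceSol hp θ t (y + g) = laplaceSol hp θ t y * Real.exp (-(g * psi hp t θ)) := by
    rw [laplaceSol, laplaceSol, ← Real.exp_add]
    congr 1
    ring
  rw [generatorL, hd.deriv, hs, laplaceGen, branching]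
  have := hp.g_pos.ne'
  field_simp
  ring

lemma abs_branching_sub_le {θ t y : ℝ} (hθ : 0 < θ) (ht : 0 ≤ t) (hy : 0 ≤ y) :
    |y * branching pA pB g (psi hp t θ) - (1 - pA) * psi hp t θ| ≤ (1 + y) * θ := by
  have h1 := psi_pos hp t θ
  have h2 := psi_le_self hp ht hθ
  have h3 := branching_pos hp h1
  have h4 := branching_le hp h1.le
  have h5 : branching pA pB g (psi hp t θ) ≤ θ :=
    h4.trans ((mul_le_of_le_one_left h1.le hp.lt_one.le).trans h2)
  have h6 : y * branching pA pB g (psi hp t θ) ≤ y * θ := mul_le_mul_of_nonneg_left h5 hy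
  have h7 : 0 ≤ y * branching pA pB g (psi hp t θ) := mul_nonneg hy h3.le
  have h8 : (1 - pA) * psi hp t θ ≤ θ :=
    (mul_le_of_le_one_left h1.le (by linarith [hp.pA_pos])).trans h2
  have h9 : 0 ≤ (1 - pA) * psi hp t θ := mul_nonneg (by linarith [hp.lt_one]) h1.le
  have h10 : 0 ≤ y * θ := mul_nonneg hy hθ.le
  rw [abs_le]
  constructor <;> linarith

omit hp in
lemma one_add_le_exp {c y : ℝ} (hc : 0 < c) (hy : 0 ≤ y) :
    1 + y ≤ (1 + 1 / c) * Real.exp (c * y) := by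
  have h1 := Real.add_one_le_exp (c * y)
  have h2 : (1 + 1 / c) * (c * y + 1) ≤ (1 + 1 / c) * Real.exp (c * y) :=
    mul_le_mul_of_nonneg_left h1 (by positivity)
  have h3 : (1 + 1 / c) * (c * y + 1) = 1 + y + c * y + 1 / c := by
    field_simp
    ring
  have h4 : 0 ≤ c * y := by positivity
  have h5 : 0 < 1 / c := by positivity
  linarith

lemma laplaceSol_le {θ t T y : ℝ} (hθ : 0 < θ) (ht : 0 ≤ t) (htT : t ≤ T) (hy : 0 ≤ y) :
    laplaceSol hp θ t y ≤ Real.exp (-(θ * Real.exp (-(pA * T)) * y)) := by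
  refine (laplaceSol_le_exp hp hθ ht).trans (Real.exp_le_exp.mpr (neg_le_neg ?_))
  refine mul_le_mul_of_nonneg_right (le_trans ?_ (le_psi hp ht hθ)) hy
  refine mul_le_mul_of_nonneg_left (Real.exp_le_exp.mpr ?_) hθ.le
  have := mul_le_mul_of_nonneg_left htT hp.pA_pos.le
  linarith

lemma exists_laplaceGen_bound {θ : ℝ} (hθ : 0 < θ) (T : ℝ) :
    ∃ C, ∀ t, 0 ≤ t → t ≤ T → ∀ y, 0 ≤ y → |laplaceGen hp θ t y| ≤ C := by
  set c := θ * Real.exp (-(pA * T)) with hc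
  have hc0 : 0 < c := mul_pos hθ (Real.exp_pos _)
  refine ⟨(1 + 1 / c) * θ, fun t ht htT y hy => ?_⟩
  have h1 := abs_branching_sub_le hp hθ ht hy
  have h2 := laplaceSol_le hp hθ ht htT hy
  have h3 := one_add_le_exp hc0 hy
  rw [laplaceGen, abs_mul, abs_of_pos (laplaceSol_pos hp θ t y)]
  calc _ ≤ (1 + y) * θ * Real.exp (-(c * y)) :=
        mul_le_mul h1 h2 (Real.exp_pos _).le (by positivity)
    _ ≤ (1 + 1 / c) * Real.exp (c * y) * θ * Real.exp (-(c * y)) := by gcongr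
    _ = (1 + 1 / c) * θ * (Real.exp (c * y) * Real.exp (-(c * y))) := by ring
    _ = (1 + 1 / c) * θ := by rw [← Real.exp_add, add_neg_cancel, Real.exp_zero, mul_one]

/-- The second time derivative of `laplaceSol` is bounded, uniformly in space. -/
lemma exists_laplaceGen_deriv_bound {θ : ℝ} (hθ : 0 < θ) (T : ℝ) :
    ∃ C, ∀ t, 0 ≤ t → t ≤ T → ∀ y, 0 ≤ y → |deriv (fun t => laplaceGen hp θ t y) t| ≤ C := by
  set c := θ * Real.exp (-(pA * T)) with hc
  have hc0 : 0 < c := mul_pos hθ (Real.exp_pos _)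
  refine ⟨(1 + 1 / (c / 2)) ^ 2 * (θ + θ ^ 2), fun t ht htT y hy => ?_⟩
  have hfac : ∀ a b s : ℝ, a * s + b * (b * s) = (a + b * b) * s := fun a b s => by ring
  rw [(hasDerivAt_laplaceGen hp θ t y).deriv, laplaceGen, hfac, abs_mul,
    abs_of_pos (laplaceSol_pos hp θ t y)]
  have h1 := abs_branching_sub_le hp hθ ht hy
  have h2 := laplaceSol_le hp hθ ht htT hy
  have h3 := one_add_le_exp (half_pos hc0) hy
  have hψ := psi_pos hp t θ
  set R := branching pA pB g (psi hp t θ) with hR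
  have hR0 : 0 < R := branching_pos hp hψ
  have hRθ : R ≤ θ := (branching_le hp hψ.le).trans
    ((mul_le_of_le_one_left hψ.le hp.lt_one.le).trans (psi_le_self hp ht hθ))
  set d := pA - pB * Real.exp (-(g * psi hp t θ)) with hd
  have he : Real.exp (-(g * psi hp t θ)) ≤ 1 :=
    Real.exp_le_one_iff.mpr (by linarith [mul_pos hp.g_pos hψ])
  have hd1 : d ≤ 1 := by
    have := mul_pos hp.pB_pos (Real.exp_pos (-(g * psi hp t θ)))
    linarith [hp.lt_one]
  have hd0 : 0 ≤ d := by
    have := mul_le_mul_of_nonneg_left he hp.pB_pos.le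
    linarith [hp.lt]
  have h4 : |y * (d * -R) - (1 - pA) * -R| ≤ (1 + y) * θ := by
    have e1 : d * R ≤ θ := (mul_le_of_le_one_left hR0.le hd1).trans hRθ
    have e2 : 0 ≤ d * R := mul_nonneg hd0 hR0.le
    have e3 : (1 - pA) * R ≤ θ :=
      (mul_le_of_le_one_left hR0.le (by linarith [hp.pA_pos])).trans hRθ
    have e4 : 0 ≤ (1 - pA) * R := mul_nonneg (by linarith [hp.lt_one]) hR0.le
    have e5 := mul_le_mul_of_nonneg_left e1 hy
    have e6 := mul_nonneg hy e2
    have e7 := mul_nonneg hy hθ.le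
    have e8 : y * (d * -R) - (1 - pA) * -R = (1 - pA) * R - y * (d * R) := by ring
    rw [e8, abs_le]
    constructor <;> linarith
  have h5 : |y * (d * -R) - (1 - pA) * -R + (y * R - (1 - pA) * psi hp t θ) *
      (y * R - (1 - pA) * psi hp t θ)| ≤ (1 + y) ^ 2 * (θ + θ ^ 2) := by
    refine (abs_add_le _ _).trans ?_
    rw [abs_mul]
    have e1 := mul_le_mul h1 h1 (abs_nonneg _) (by positivity)
    have e2 : (1 + y) * θ ≤ (1 + y) ^ 2 * θ := by
      have : 0 ≤ y * (1 + y) * θ := by positivity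
      linarith [this, (by ring : (1 + y) ^ 2 * θ = (1 + y) * θ + y * (1 + y) * θ)]
    calc _ ≤ (1 + y) ^ 2 * θ + (1 + y) * θ * ((1 + y) * θ) := add_le_add (h4.trans e2) e1
      _ = _ := by ring
  calc _ ≤ (1 + y) ^ 2 * (θ + θ ^ 2) * Real.exp (-(c * y)) :=
        mul_le_mul h5 h2 (Real.exp_pos _).le (by positivity)
    _ ≤ ((1 + 1 / (c / 2)) * Real.exp (c / 2 * y)) ^ 2 * (θ + θ ^ 2) * Real.exp (-(c * y)) := by
        gcongr
    _ = (1 + 1 / (c / 2)) ^ 2 * (θ + θ ^ 2) *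
        (Real.exp (c / 2 * y) * Real.exp (c / 2 * y) * Real.exp (-(c * y))) := by ring
    _ = (1 + 1 / (c / 2)) ^ 2 * (θ + θ ^ 2) := by
        rw [← Real.exp_add, ← Real.exp_add,
          (by ring : c / 2 * y + c / 2 * y + -(c * y) = 0), Real.exp_zero, mul_one]

omit hp in
/-- A Taylor estimate of order two, from a bound on the second derivative. -/
lemma abs_taylor_two_le {F F' : ℝ → ℝ} (hF : ∀ t, HasDerivAt F (F' t) t)
    (hF' : Differentiable ℝ F') {C t : ℝ} (ht : 0 ≤ t)
    (hC : ∀ s ∈ Set.Icc 0 t, |deriv F' s| ≤ C) : |F t - F 0 - t * F' 0| ≤ C * t * t := by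
  have h1 : ∀ s ∈ Set.Icc 0 t, |F' s - F' 0| ≤ C * t := by
    intro s hs
    have := (convex_Icc 0 t).norm_image_sub_le_of_norm_deriv_le (fun x _ => (hF' x))
      (fun x hx => hC x hx) (Set.left_mem_Icc.mpr ht) hs
    refine this.trans ?_
    rw [sub_zero, Real.norm_of_nonneg hs.1]
    exact mul_le_mul_of_nonneg_left hs.2 ((abs_nonneg _).trans (hC s hs))
  have h2 : ∀ s, HasDerivAt (fun s => F s - s * F' 0) (F' s - 1 * F' 0) s := fun s =>
    (hF s).sub ((hasDerivAt_id s).mul_const _)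
  have h3 := (convex_Icc 0 t).norm_image_sub_le_of_norm_deriv_le
    (f := fun s => F s - s * F' 0) (C := C * t) (fun x _ => (h2 x).differentiableAt)
    (fun x hx => by rw [(h2 x).deriv, one_mul]; exact h1 x hx)
    (Set.left_mem_Icc.mpr ht) (Set.right_mem_Icc.mpr ht)
  rw [sub_zero, Real.norm_of_nonneg ht, Real.norm_eq_abs] at h3
  refine le_trans (le_of_eq ?_) h3
  congr 1
  ring

lemma tendstoUniformly_laplaceSol_zero {θ : ℝ} (hθ : 0 < θ) :
    TendstoUniformly (fun (h : ℝ≥0) (y : ℝ≥0) =>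
      (laplaceSol hp θ h y - laplaceSol hp θ 0 y) / (h : ℝ))
      (fun y : ℝ≥0 => laplaceGen hp θ 0 y) (𝓝[>] 0) := by
  obtain ⟨C, hC⟩ := exists_laplaceGen_deriv_bound hp hθ 1
  have hC0 : 0 ≤ C := (abs_nonneg _).trans (hC 0 le_rfl zero_le_one 0 le_rfl)
  rw [Metric.tendstoUniformly_iff]
  intro ε hε
  have h1 : ∀ᶠ h : ℝ≥0 in 𝓝[>] 0, (h : ℝ) < min 1 (ε / (C + 1)) := by
    have : ∀ᶠ h : ℝ≥0 in 𝓝 0, (h : ℝ) < min 1 (ε / (C + 1)) :=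
      NNReal.continuous_coe.continuousAt.eventually
        (gt_mem_nhds (by simpa using lt_min one_pos (by positivity : 0 < ε / (C + 1))))
    exact this.filter_mono nhdsWithin_le_nhds
  filter_upwards [h1, self_mem_nhdsWithin] with h hh hh0 y
  have hh0' : (0 : ℝ) < h := by exact_mod_cast hh0
  have hh1 : (h : ℝ) ≤ 1 := (hh.trans_le (min_le_left _ _)).le
  have hh2 : (h : ℝ) < ε / (C + 1) := hh.trans_le (min_le_right _ _)
  have h2 := abs_taylor_two_le (fun t => hasDerivAt_laplaceSol hp θ t y)
    (fun t => (hasDerivAt_laplaceGen hp θ t y).differentiableAt) h.coe_nonneg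
    (fun s hs => hC s hs.1 (hs.2.trans hh1) y y.coe_nonneg)
  rw [lt_div_iff₀ (by positivity)] at hh2
  rw [Real.dist_eq, abs_sub_comm]
  have h3 : (laplaceSol hp θ h y - laplaceSol hp θ 0 y) / (h : ℝ) - laplaceGen hp θ 0 y =
      (laplaceSol hp θ h y - laplaceSol hp θ 0 y - h * laplaceGen hp θ 0 y) / h := by
    field_simp
  rw [h3, abs_div, abs_of_pos hh0', div_lt_iff₀ hh0']
  refine h2.trans_lt ?_
  exact mul_lt_mul_of_pos_right (by linarith [mul_add (h : ℝ) C 1]) hh0'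

lemma tendstoUniformly_laplaceSol {θ : ℝ} (s : ℝ) :
    TendstoUniformly (fun (h : ℝ≥0) (y : ℝ≥0) =>
      (laplaceSol hp θ (s + h) y - laplaceSol hp θ s y) / (h : ℝ))
      (fun y : ℝ≥0 => laplaceGen hp θ s y) (𝓝[>] 0) := by
  set a := Real.exp (-(immigration pA pB g θ) + immigration pA pB g (psi hp s θ)) with ha
  have h1 := tendstoUniformly_laplaceSol_zero hp (psi_pos hp s θ)
  have hu : UniformContinuous fun x : ℝ => a * x := uniformContinuous_mul_left' a
  have h0 : ∀ y, laplaceSol hp θ s y = a * laplaceSol hp (psi hp s θ) 0 y := fun y => by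
    rw [← laplaceSol_add, zero_add]
  convert hu.comp_tendstoUniformly h1 using 1
  · ext h y
    simp only [Function.comp]
    rw [add_comm s, laplaceSol_add, h0, ← ha]
    ring
  · ext y
    simp only [Function.comp, laplaceGen]
    rw [h0, psi_zero hp (psi_pos hp s θ)]
    ring

end

section
variable {pA pB g : ℝ}

lemma generatorL_sub {f₁ f₂ : ℝ → ℝ} {y : ℝ≥0} (h₁ : DifferentiableAt ℝ f₁ y)
    (h₂ : DifferentiableAt ℝ f₂ y) :
    generatorL pA pB g (fun x => f₁ x - f₂ x) y =
      generatorL pA pB g f₁ y - generatorL pA pB g f₂ y := by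
  simp only [generatorL]
  rw [deriv_fun_sub h₁ h₂]
  ring

lemma generatorL_sum {ι : Type*} (s : Finset ι) {f : ι → ℝ → ℝ} (c : ι → ℝ) {y : ℝ≥0}
    (h : ∀ i ∈ s, DifferentiableAt ℝ (f i) y) :
    generatorL pA pB g (fun x => ∑ i ∈ s, c i * f i x) y =
      ∑ i ∈ s, c i * generatorL pA pB g (f i) y := by
  simp only [generatorL]
  rw [deriv_fun_sum fun i hi => (h i hi).const_mul (c i), ← Finset.sum_sub_distrib, Finset.sum_div,
    Finset.mul_sum, Finset.mul_sum, ← Finset.sum_add_distrib]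
  refine Finset.sum_congr rfl fun i hi => ?_
  rw [deriv_const_mul (c i) (h i hi)]
  ring

/-- A function vanishing at infinity whose derivative decays exponentially decays exponentially. -/
lemma abs_le_of_abs_deriv_le {D : ℝ → ℝ} (hD : ∀ y, 0 ≤ y → DifferentiableAt ℝ D y)
    (h0 : Tendsto D atTop (𝓝 0)) {c ε : ℝ} (hc : 0 < c)
    (hd : ∀ y, 0 ≤ y → |deriv D y| ≤ ε * Real.exp (-(c * y))) {y : ℝ} (hy : 0 ≤ y) :
    |D y| ≤ ε / c * Real.exp (-(c * y)) := by
  have hE : ∀ x, HasDerivAt (fun x => ε / c * Real.exp (-(c * x)))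
      (-(ε * Real.exp (-(c * x)))) x := fun x => by
    refine ((((hasDerivAt_id x).const_mul c).neg.exp).const_mul (ε / c)).congr_deriv ?_
    simp only [id, Pi.neg_apply]
    field_simp
  have hE0 : Tendsto (fun x => ε / c * Real.exp (-(c * x))) atTop (𝓝 0) := by
    have := ((Real.tendsto_exp_neg_atTop_nhds_zero.comp (tendsto_id.const_mul_atTop hc)).const_mul
      (ε / c))
    simpa using this
  have key : ∀ σ : ℝ, |σ| = 1 → 0 ≤ ε / c * Real.exp (-(c * y)) + σ * D y := by
    intro σ hσ
    have hH : ∀ x, 0 ≤ x → HasDerivAt (fun x => ε / c * Real.exp (-(c * x)) + σ * D x)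
        (-(ε * Real.exp (-(c * x))) + σ * deriv D x) x := fun x hx =>
      (hE x).add ((hD x hx).hasDerivAt.const_mul σ)
    have hanti : AntitoneOn (fun x => ε / c * Real.exp (-(c * x)) + σ * D x) (Set.Ici 0) := by
      refine antitoneOn_of_deriv_nonpos (convex_Ici 0)
        (fun x hx => (hH x hx).continuousAt.continuousWithinAt) ?_ ?_
      · intro x hx
        rw [interior_Ici] at hx
        exact (hH x (le_of_lt hx)).differentiableAt.differentiableWithinAt
      · intro x hx
        rw [interior_Ici] at hx
        rw [(hH x (le_of_lt hx)).deriv]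
        have h1 := hd x (le_of_lt hx)
        have h2 : σ * deriv D x ≤ |deriv D x| := by
          refine (le_abs_self _).trans ?_
          rw [abs_mul, hσ, one_mul]
        linarith
    have hlim : Tendsto (fun x => ε / c * Real.exp (-(c * x)) + σ * D x) atTop (𝓝 0) := by
      simpa using hE0.add (h0.const_mul σ)
    refine le_of_tendsto hlim ?_
    filter_upwards [eventually_ge_atTop y] with x hx
    exact hanti (Set.mem_Ici.mpr hy) (Set.mem_Ici.mpr (hy.trans hx)) hx
  have h1 := key 1 (by simp)
  have h2 := key (-1) (by simp)
  rw [abs_le]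
  constructor <;> linarith

lemma abs_generatorL_le (hp : Admissible pA pB g) {D : ℝ → ℝ} {c ε : ℝ} (hc : 0 < c) (hε : 0 ≤ ε)
    (hD : ∀ y, 0 ≤ y → |D y| ≤ ε / c * Real.exp (-(c * y)))
    (hd : ∀ y, 0 ≤ y → |deriv D y| ≤ ε * Real.exp (-(c * y))) (y : ℝ≥0) :
    |generatorL pA pB g D y| ≤ ((1 + 1 / c) * (2 * (pB / g / c) + 1)) * ε := by
  have hg := hp.g_pos
  have hB := hp.pB_pos
  have hy : (0 : ℝ) ≤ y := y.2
  have h1 := hD y hy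
  have h2 := hd y hy
  have h3 : |D (y + g)| ≤ ε / c * Real.exp (-(c * y)) := by
    refine (hD _ (by positivity)).trans (mul_le_mul_of_nonneg_left (Real.exp_le_exp.mpr ?_)
      (by positivity))
    have := mul_pos hc hg
    linarith [mul_add c (y : ℝ) g]
  have h4 : |(D (y + g) - D y) / g| ≤ 2 * (ε / c * Real.exp (-(c * y))) / g := by
    rw [abs_div, abs_of_pos hg]
    gcongr
    refine (abs_sub _ _).trans ?_
    linarith
  have h5 : |1 - pA - pA * (y : ℝ)| ≤ 1 + y := by
    have e1 := mul_nonneg hp.pA_pos.le hy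
    have e2 : pA * (y : ℝ) ≤ y := mul_le_of_le_one_left hy hp.lt_one.le
    rw [abs_le]
    constructor <;> linarith [hp.lt_one, hp.pA_pos]
  have h6 : |pB * (y : ℝ)| ≤ pB * (1 + y) := by
    rw [abs_of_nonneg (by positivity)]
    gcongr
    linarith
  have h7 := one_add_le_exp hc hy
  unfold generatorL
  refine (abs_add_le _ _).trans ?_
  rw [abs_mul, abs_mul (1 - pA - pA * (y : ℝ))]
  calc _ ≤ pB * (1 + y) * (2 * (ε / c * Real.exp (-(c * y))) / g)
        + (1 + y) * (ε * Real.exp (-(c * y))) :=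
        add_le_add (mul_le_mul h6 h4 (abs_nonneg _) (by positivity))
          (mul_le_mul h5 h2 (abs_nonneg _) (by positivity))
    _ = (1 + y) * ((2 * (pB / g / c) + 1) * ε * Real.exp (-(c * y))) := by field_simp
    _ ≤ ((1 + 1 / c) * Real.exp (c * y)) * ((2 * (pB / g / c) + 1) * ε * Real.exp (-(c * y))) :=
        mul_le_mul_of_nonneg_right h7 (by positivity)
    _ = ((1 + 1 / c) * (2 * (pB / g / c) + 1)) * ε * (Real.exp (c * y) * Real.exp (-(c * y))) := by
        ring
    _ = _ := by rw [← Real.exp_add, add_neg_cancel, Real.exp_zero, mul_one]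

/-- The generator on `f` is obtained by approximating `f'` in an exponentially weighted uniform
norm by derivatives of functions on which the generator is known. -/
lemma IsGen.of_deriv_approx (hp : Admissible pA pB g) {Q : ℝ≥0 → Kernel ℝ≥0 ℝ≥0}
    (hQ : IsTransitionSemigroup Q) {f : ℝ → ℝ} (hf : Differentiable ℝ f)
    (hb : ∃ C, ∀ y : ℝ≥0, |f y| ≤ C) {c : ℝ} (hc : 0 < c)
    (h : ∀ ε > 0, ∃ f' : ℝ → ℝ, Differentiable ℝ f' ∧
      IsGen Q (fun y => f' y) (generatorL pA pB g f') ∧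
      Tendsto (fun y => f y - f' y) atTop (𝓝 0) ∧
      ∀ y, 0 ≤ y → |deriv f y - deriv f' y| ≤ ε * Real.exp (-(c * y))) :
    IsGen Q (fun y => f y) (generatorL pA pB g f) := by
  refine IsGen.of_approx hQ (hf.continuous.measurable.comp measurable_subtype_coe) hb ?_
  intro ε hε
  have hg := hp.g_pos
  have hB := hp.pB_pos
  set K := ((1 + 1 / c) * (2 * (pB / g / c) + 1)) with hK
  have hK0 : 0 < K := by positivity
  set δ := min (ε * c) (ε / K) with hδ
  have hδ0 : 0 < δ := lt_min (by positivity) (by positivity)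
  obtain ⟨f', hf', hgen, h0, hd⟩ := h δ hδ0
  have hd' : ∀ y, 0 ≤ y → |deriv (fun y => f y - f' y) y| ≤ δ * Real.exp (-(c * y)) := by
    intro y hy
    rw [deriv_fun_sub (hf y) (hf' y)]
    exact hd y hy
  have hD := fun y (hy : 0 ≤ y) =>
    abs_le_of_abs_deriv_le (fun y _ => (hf y).sub (hf' y)) h0 hc hd' (y := y) hy
  refine ⟨fun y => f' y, generatorL pA pB g f', hgen, fun y => ?_, fun y => ?_⟩
  · refine (hD y y.2).trans ?_
    have h1 : Real.exp (-(c * y)) ≤ 1 := Real.exp_le_one_iff.mpr (by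
      have := mul_nonneg hc.le y.2
      exact neg_nonpos.mpr this)
    have h2 : δ / c ≤ ε := by
      rw [div_le_iff₀ hc]
      exact min_le_left _ _
    exact (mul_le_of_le_one_right (by positivity) h1).trans h2
  · rw [← generatorL_sub (hf y) (hf' y)]
    refine (abs_generatorL_le hp hc hδ0.le hD hd' y).trans ?_
    rw [← hK, mul_comm, ← le_div_iff₀ hK0]
    exact min_le_right _ _

end

section
variable {pA pB g : ℝ}

lemma hasDerivAt_exp_neg_mul (θ y : ℝ) :
    HasDerivAt (fun y => Real.exp (-(θ * y))) (-θ * Real.exp (-(θ * y))) y := by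
  refine (((hasDerivAt_id y).const_mul θ).neg.exp).congr_deriv ?_
  simp only [id, Pi.neg_apply]
  ring

lemma tendsto_exp_neg_mul {θ : ℝ} (hθ : 0 < θ) :
    Tendsto (fun y => Real.exp (-(θ * y))) atTop (𝓝 0) :=
  Real.tendsto_exp_neg_atTop_nhds_zero.comp (tendsto_id.const_mul_atTop hθ)

lemma abs_exp_neg_mul_le {θ : ℝ} (hθ : 0 ≤ θ) (y : ℝ≥0) : |Real.exp (-(θ * y))| ≤ 1 := by
  rw [Real.abs_exp, Real.exp_le_one_iff]
  have := mul_nonneg hθ y.coe_nonneg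
  linarith

lemma eventually_eq_zero_of_hasCompactSupport {f : ℝ → ℝ} (hf : HasCompactSupport f) :
    ∀ᶠ y in atTop, f y = 0 := by
  have h := hasCompactSupport_iff_eventuallyEq.mp hf
  rw [coclosedCompact_eq_cocompact] at h
  exact h.filter_mono atTop_le_cocompact

/-- Exponentials belong to the domain of the generator: they are approximated by smooth
truncations. -/
lemma IsMarkovSemigroupWithGeneratorL.isGen_exp (hp : Admissible pA pB g)
    {Q : ℝ≥0 → Kernel ℝ≥0 ℝ≥0} (hQ : IsMarkovSemigroupWithGeneratorL pA pB g Q) {θ : ℝ}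
    (hθ : 0 < θ) : IsGen Q (fun y => Real.exp (-(θ * y)))
      (generatorL pA pB g fun y => Real.exp (-(θ * y))) := by
  obtain ⟨b, hbd, hbc, hb1', hb0, hble⟩ : ∃ b : ℝ → ℝ, ContDiff ℝ 1 b ∧ HasCompactSupport b ∧
      (∀ x ∈ Metric.closedBall (0 : ℝ) 1, b x = 1) ∧ (∀ x, 0 ≤ b x) ∧ ∀ x, b x ≤ 1 := by
    let b : ContDiffBump (0 : ℝ) := ⟨1, 2, one_pos, one_lt_two⟩
    exact ⟨b, b.contDiff, b.hasCompactSupport, fun x hx => b.one_of_mem_closedBall hx,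
      fun x => b.nonneg, fun x => b.le_one⟩
  have hbdiff : Differentiable ℝ b := hbd.differentiable one_ne_zero
  obtain ⟨C, hC⟩ := (hbd.continuous_deriv le_rfl).bounded_above_of_compact_support hbc.deriv
  have hC0 : 0 ≤ C := (norm_nonneg _).trans (hC 0)
  have hb1 : ∀ x, 0 ≤ x → x < 1 → b x = 1 ∧ deriv b x = 0 := by
    intro x hx hx1
    have h : b =ᶠ[𝓝 x] fun _ => 1 := by
      have : Metric.ball (0 : ℝ) 1 ∈ 𝓝 x := Metric.isOpen_ball.mem_nhds (by
        rw [Metric.mem_ball, dist_zero_right, Real.norm_of_nonneg hx]; exact hx1)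
      filter_upwards [this] with z hz
      exact hb1' z (Metric.ball_subset_closedBall hz)
    exact ⟨h.eq_of_nhds, by rw [h.deriv_eq, deriv_const]⟩
  refine IsGen.of_deriv_approx hp hQ.toIsTransitionSemigroup (c := θ / 2)
    (fun y => (hasDerivAt_exp_neg_mul θ y).differentiableAt)
    ⟨1, fun y => abs_exp_neg_mul_le hθ.le y⟩ (half_pos hθ) ?_
  intro ε hε
  have hlim : Tendsto (fun n : ℕ => (θ + C) * Real.exp (-(θ / 2 * n))) atTop (𝓝 0) := by
    simpa using ((tendsto_exp_neg_mul (half_pos hθ)).comp tendsto_natCast_atTop_atTop).const_mul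
      (θ + C)
  obtain ⟨n, hn, hn1⟩ := ((hlim.eventually (gt_mem_nhds hε)).and (eventually_ge_atTop 1)).exists
  have hn1' : (1 : ℝ) ≤ n := by exact_mod_cast hn1
  have hn0 : (0 : ℝ) < n := by linarith
  set f' : ℝ → ℝ := fun y => Real.exp (-(θ * y)) * b (y / n) with hf'
  have hd : ∀ y, HasDerivAt f' (-θ * Real.exp (-(θ * y)) * b (y / n) +
      Real.exp (-(θ * y)) * (deriv b (y / n) * (1 / n))) y := fun y =>
    (hasDerivAt_exp_neg_mul θ y).mul
      ((hbdiff (y / n)).hasDerivAt.comp y ((hasDerivAt_id y).div_const (n : ℝ)))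
  have hcs : HasCompactSupport fun y : ℝ => b (y / n) := by
    have := hbc.comp_homeomorph (Homeomorph.mulRight₀ (n : ℝ)⁻¹ (by positivity))
    exact this
  have hcs' : HasCompactSupport f' := hcs.mul_left
  have hcd : ContDiff ℝ 1 f' := by
    have h1 : ContDiff ℝ 1 fun y : ℝ => b (y / n) :=
      hbd.comp (contDiff_id.div_const (n : ℝ))
    exact (Real.contDiff_exp.comp (contDiff_const.mul contDiff_id).neg).mul h1
  have hfb := hcd.continuous.bounded_above_of_compact_support hcs'
  refine ⟨f', fun y => (hd y).differentiableAt, ⟨?_, ?_, hQ.generator f' hcd hcs'⟩, ?_, ?_⟩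
  · exact hcd.continuous.measurable.comp measurable_subtype_coe
  · obtain ⟨D, hD⟩ := hfb
    exact ⟨D, fun y => hD y⟩
  · have h1 : Tendsto f' atTop (𝓝 0) := by
      exact (tendsto_congr' (eventually_eq_zero_of_hasCompactSupport hcs')).mpr tendsto_const_nhds
    simpa using (tendsto_exp_neg_mul hθ).sub h1
  · intro y hy
    rw [(hasDerivAt_exp_neg_mul θ y).deriv, (hd y).deriv]
    rcases lt_or_ge y n with hyn | hyn
    · obtain ⟨e1, e2⟩ := hb1 (y / n) (by positivity) ((div_lt_one hn0).mpr hyn)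
      rw [e1, e2]
      simp only [mul_one, zero_mul, mul_zero, add_zero, sub_self, abs_zero]
      positivity
    · have e1 : |1 - b (y / n)| ≤ 1 := by
        rw [abs_of_nonneg (by linarith [hble (y / n)])]
        linarith [hb0 (y / n)]
      have e2 : |deriv b (y / n) * (1 / n)| ≤ C := by
        rw [abs_mul, abs_of_pos (by positivity : (0 : ℝ) < 1 / n)]
        have : 1 / (n : ℝ) ≤ 1 := (div_le_one hn0).mpr hn1'
        exact (mul_le_mul (hC _) this (by positivity) hC0).trans (mul_one C).le
      have e3 : -θ * Real.exp (-(θ * y)) - (-θ * Real.exp (-(θ * y)) * b (y / n) +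
          Real.exp (-(θ * y)) * (deriv b (y / n) * (1 / n))) =
          (-(θ * (1 - b (y / n))) - deriv b (y / n) * (1 / n)) * Real.exp (-(θ * y)) := by ring
      rw [e3, abs_mul, Real.abs_exp]
      have e4 : |-(θ * (1 - b (y / n))) - deriv b (y / n) * (1 / n)| ≤ θ + C := by
        refine (abs_sub _ _).trans (add_le_add ?_ e2)
        rw [abs_neg, abs_mul, abs_of_pos hθ]
        exact mul_le_of_le_one_right hθ.le e1
      have e5 : Real.exp (-(θ * y)) ≤ Real.exp (-(θ / 2 * n)) * Real.exp (-(θ / 2 * y)) := by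
        rw [← Real.exp_add, Real.exp_le_exp]
        have := mul_le_mul_of_nonneg_left hyn (half_pos hθ).le
        linarith
      calc _ ≤ (θ + C) * (Real.exp (-(θ / 2 * n)) * Real.exp (-(θ / 2 * y))) :=
            mul_le_mul e4 e5 (Real.exp_pos _).le (by positivity)
        _ = (θ + C) * Real.exp (-(θ / 2 * n)) * Real.exp (-(θ / 2 * y)) := by ring
        _ ≤ _ := by gcongr

/-- Conversely, if the generator acts on the exponentials `exp (-n y)` as `L`, it does so on `C¹`
functions with compact support: in the variable `x = exp (-y)`, approximate `f' / x ^ 2` by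
polynomials. -/
lemma isGen_of_exp (hp : Admissible pA pB g)
    {Q : ℝ≥0 → Kernel ℝ≥0 ℝ≥0} (hQ : IsTransitionSemigroup Q)
    (hexp : ∀ θ : ℝ, 0 < θ → IsGen Q (fun y => Real.exp (-(θ * y)))
      (generatorL pA pB g fun y => Real.exp (-(θ * y))))
    {f : ℝ → ℝ} (hf : ContDiff ℝ 1 f) (hfc : HasCompactSupport f) :
    IsGen Q (fun y => f y) (generatorL pA pB g f) := by
  refine IsGen.of_deriv_approx hp hQ (c := 2) (hf.differentiable one_ne_zero)
    ((hf.continuous.bounded_above_of_compact_support hfc).imp fun C hC y => hC y) two_pos ?_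
  intro ε hε
  have hfd : Continuous (deriv f) := hf.continuous_deriv le_rfl
  set k : ℝ → ℝ := fun x => deriv f (-Real.log x) / x ^ 2 with hk
  have hkc : Continuous k := by
    rw [continuous_iff_continuousAt]
    intro x
    rcases eq_or_ne x 0 with rfl | hx
    · have h1 : ∀ᶠ y in atTop, deriv f y = 0 := eventually_eq_zero_of_hasCompactSupport hfc.deriv
      have h2 : Tendsto (fun x => -Real.log x) (𝓝[≠] 0) atTop :=
        tendsto_neg_atBot_atTop.comp Real.tendsto_log_nhdsNE_zero
      have h3 : k =ᶠ[𝓝 0] fun _ => 0 := by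
        have h4 : ∀ᶠ x in 𝓝[≠] (0 : ℝ), k x = 0 := by
          filter_upwards [h2.eventually h1] with x hx
          simp [hk, hx]
        rw [eventually_nhdsWithin_iff] at h4
        filter_upwards [h4] with x hx
        rcases eq_or_ne x 0 with rfl | hx0
        · simp [hk]
        · exact hx hx0
      exact continuousAt_const.congr h3.symm
    · exact (hfd.continuousAt.comp (Real.continuousAt_log hx).neg).div
        (continuousAt_id.pow 2) (pow_ne_zero 2 hx)
  obtain ⟨q, hq⟩ := exists_polynomial_near_of_continuousOn 0 1 k hkc.continuousOn ε hε
  set c : ℕ → ℝ := fun n => -(q.coeff n / (n + 2)) with hc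
  set e : ℕ → ℝ → ℝ := fun n y => Real.exp (-(((n : ℝ) + 2) * y)) with he
  have hed : ∀ n y, DifferentiableAt ℝ (e n) y :=
    fun n y => (hasDerivAt_exp_neg_mul _ y).differentiableAt
  refine ⟨fun y => ∑ n ∈ q.support, c n * e n y, ?_, ?_, ?_, ?_⟩
  · intro y
    exact DifferentiableAt.fun_sum fun n _ => (hed n y).const_mul _
  · have h1 := IsGen.sum q.support hQ.isMarkov
      (fun n _ => (hexp ((n : ℝ) + 2) (by positivity)).const_mul (c n))
    convert h1 using 1
    ext y
    exact generatorL_sum q.support c fun n _ => hed n y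
  · have h1 : Tendsto f atTop (𝓝 0) :=
      (tendsto_congr' (eventually_eq_zero_of_hasCompactSupport hfc)).mpr tendsto_const_nhds
    have h2 : Tendsto (fun y => ∑ n ∈ q.support, c n * e n y) atTop
        (𝓝 (∑ n ∈ q.support, c n * 0)) :=
      tendsto_finsetSum _ fun n _ => (tendsto_exp_neg_mul (by positivity)).const_mul _
    simpa using h1.sub h2
  · intro y hy
    have h1 : deriv (fun y => ∑ n ∈ q.support, c n * e n y) y =
        q.eval (Real.exp (-y)) * Real.exp (-(2 * y)) := by
      rw [deriv_fun_sum fun n _ => (hed n y).const_mul (c n), Polynomial.eval_eq_sum,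
        Polynomial.sum, Finset.sum_mul]
      refine Finset.sum_congr rfl fun n _ => ?_
      rw [deriv_const_mul _ (hed n y), (hasDerivAt_exp_neg_mul _ y).deriv, ← Real.exp_nat_mul,
        mul_assoc, ← Real.exp_add]
      have h2 : (n : ℝ) * -y + -(2 * y) = -(((n : ℝ) + 2) * y) := by ring
      rw [h2]
      simp only [hc]
      field_simp
    have h3 : deriv f y = k (Real.exp (-y)) * Real.exp (-(2 * y)) := by
      simp only [hk, Real.log_exp, neg_neg]
      rw [← Real.exp_nat_mul, div_mul_eq_mul_div, eq_div_iff (Real.exp_pos _).ne']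
      congr 2
      push_cast
      ring
    rw [h1, h3, ← sub_mul, abs_mul, Real.abs_exp, abs_sub_comm]
    refine mul_le_mul_of_nonneg_right (hq _ ⟨(Real.exp_pos _).le, ?_⟩).le (Real.exp_pos _).le
    exact Real.exp_le_one_iff.mpr (by linarith)

/-- The Laplace transform of a semigroup with generator `L`. -/
lemma IsMarkovSemigroupWithGeneratorL.laplace_eq (hp : Admissible pA pB g)
    {Q : ℝ≥0 → Kernel ℝ≥0 ℝ≥0} (hQ : IsMarkovSemigroupWithGeneratorL pA pB g Q) {θ : ℝ}
    (hθ : 0 < θ) (t y : ℝ≥0) :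
    ∫ z : ℝ≥0, Real.exp (-(θ * z)) ∂(Q t y) = laplaceSol hp θ t y := by
  obtain ⟨C, hC⟩ := exists_laplaceGen_bound hp hθ t
  have hgen : ∀ s ∈ Set.Icc (0 : ℝ) t,
      IsGen Q (fun y => laplaceSol hp θ s y) (fun y => laplaceGen hp θ s y) := by
    intro s hs
    have h1 := (hQ.isGen_exp hp (psi_pos hp s θ)).const_mul
      (Real.exp (-(immigration pA pB g θ) + immigration pA pB g (psi hp s θ)))
    have h2 : ∀ y, Real.exp (-(immigration pA pB g θ) + immigration pA pB g (psi hp s θ)) *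
        Real.exp (-(psi hp s θ * y)) = laplaceSol hp θ s y := fun y => by
      rw [laplaceSol, ← Real.exp_add, sub_eq_add_neg]
    convert h1 using 1
    · ext y
      exact (h2 y).symm
    · ext y
      rw [← generatorL_laplaceSol]
      have h3 := generatorL_sum (pA := pA) (pB := pB) (g := g) (y := y) (Finset.univ : Finset Unit)
        (f := fun _ y => Real.exp (-(psi hp s θ * y)))
        (fun _ => Real.exp (-(immigration pA pB g θ) + immigration pA pB g (psi hp s θ)))
        (fun _ _ => (hasDerivAt_exp_neg_mul _ _).differentiableAt)
      simp only [Finset.univ_unique, Finset.sum_singleton, h2] at h3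
      exact h3
  have h := hQ.toIsTransitionSemigroup.integral_eq_of_backward
    (u := fun s y => laplaceSol hp θ s y) (v := fun s y => laplaceGen hp θ s y) (C := C) hgen
    (fun s hs y => hC s hs.1 hs.2 y y.coe_nonneg) ?_
    (fun s _ => tendstoUniformly_laplaceSol hp s) y
  · rw [← h]
    refine integral_congr_ae (ae_of_all _ fun z => ?_)
    exact (laplaceSol_zero hp hθ z).symm
  · intro s hs s' hs' hss y
    have := (convex_Icc (0 : ℝ) t).norm_image_sub_le_of_norm_deriv_le
      (f := fun s => laplaceSol hp θ s y) (C := C)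
      (fun x _ => (hasDerivAt_laplaceSol hp θ x y).differentiableAt)
      (fun x hx => by
        rw [(hasDerivAt_laplaceSol hp θ x y).deriv]
        exact hC x hx.1 hx.2 y y.coe_nonneg) hs hs'
    rwa [Real.norm_of_nonneg (sub_nonneg.mpr hss)] at this

lemma IsMarkovSemigroupWithGeneratorL.unique (hp : Admissible pA pB g)
    {P Q : ℝ≥0 → Kernel ℝ≥0 ℝ≥0} (hP : IsMarkovSemigroupWithGeneratorL pA pB g P)
    (hQ : IsMarkovSemigroupWithGeneratorL pA pB g Q) : P = Q := by
  funext t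
  ext1 y
  have := hP.isMarkov t
  have := hQ.isMarkov t
  exact ext_of_laplace fun θ hθ => by rw [hP.laplace_eq hp hθ, hQ.laplace_eq hp hθ]

end

/-! ### Construction of the process -/

/-- The position at time `s` of the deterministic motion `y' = 1 - pA - pA y` started at `y`. -/
noncomputable def flow (pA s y : ℝ) : ℝ := (1 - pA) / pA + (y - (1 - pA) / pA) * Real.exp (-(pA * s))

/-- The jump rate integrated along the deterministic motion started at `y`, up to time `s`. -/
noncomputable def hazard (pA pB g s y : ℝ) : ℝ :=
  pB / g * ((1 - pA) / pA * s + (y - (1 - pA) / pA) * ((1 - Real.exp (-(pA * s))) / pA))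

section
variable {pA pB g : ℝ} (hp : Admissible pA pB g)
include hp

omit hp in
lemma flow_zero (y : ℝ) : flow pA 0 y = y := by simp [flow]

omit hp in
lemma hazard_zero (y : ℝ) : hazard pA pB g 0 y = 0 := by simp [hazard]

lemma mul_exp_le_flow {s y : ℝ} (hs : 0 ≤ s) : y * Real.exp (-(pA * s)) ≤ flow pA s y := by
  have h1 : Real.exp (-(pA * s)) ≤ 1 :=
    Real.exp_le_one_iff.mpr (by linarith [mul_nonneg hp.pA_pos.le hs])
  have h2 : 0 ≤ (1 - pA) / pA * (1 - Real.exp (-(pA * s))) :=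
    mul_nonneg (div_nonneg (by linarith [hp.lt_one]) hp.pA_pos.le) (by linarith)
  unfold flow
  linarith

lemma flow_nonneg {s y : ℝ} (hs : 0 ≤ s) (hy : 0 ≤ y) : 0 ≤ flow pA s y :=
  (mul_nonneg hy (Real.exp_pos _).le).trans (mul_exp_le_flow hp hs)

lemma hasDerivAt_flow (s y : ℝ) :
    HasDerivAt (fun s => flow pA s y) (1 - pA - pA * flow pA s y) s := by
  have h1 := ((hasDerivAt_exp_neg_mul pA s).const_mul (y - (1 - pA) / pA)).const_add ((1 - pA) / pA)
  refine h1.congr_deriv ?_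
  have := hp.pA_pos.ne'
  unfold flow
  field_simp
  ring

lemma hasDerivAt_hazard (s y : ℝ) :
    HasDerivAt (fun s => hazard pA pB g s y) (pB / g * flow pA s y) s := by
  have h1 := ((hasDerivAt_exp_neg_mul pA s).const_sub 1).div_const pA
  have h2 := (((hasDerivAt_id s).const_mul ((1 - pA) / pA)).add
    (h1.const_mul (y - (1 - pA) / pA))).const_mul (pB / g)
  refine h2.congr_deriv ?_
  have := hp.pA_pos.ne'
  have := hp.g_pos.ne'
  unfold flow
  field_simp

omit hp in
@[fun_prop]
lemma continuous_flow : Continuous fun q : ℝ × ℝ => flow pA q.1 q.2 := by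
  unfold flow
  fun_prop

omit hp in
@[fun_prop]
lemma continuous_hazard : Continuous fun q : ℝ × ℝ => hazard pA pB g q.1 q.2 := by
  unfold hazard
  fun_prop

omit hp in
/-- The density of the first jump time, for the motion started at `y`. -/
noncomputable def jumpDensity (pA pB g s y : ℝ) : ℝ :=
  pB / g * flow pA s y * Real.exp (-hazard pA pB g s y)

omit hp in
@[fun_prop]
lemma continuous_jumpDensity : Continuous fun q : ℝ × ℝ => jumpDensity pA pB g q.1 q.2 := by
  unfold jumpDensity
  fun_prop

lemma jumpDensity_nonneg {s y : ℝ} (hs : 0 ≤ s) (hy : 0 ≤ y) : 0 ≤ jumpDensity pA pB g s y :=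
  mul_nonneg (mul_nonneg (div_nonneg hp.pB_pos.le hp.g_pos.le) (flow_nonneg hp hs hy))
    (Real.exp_pos _).le

omit hp in
lemma ofReal_add_lintegral_neg_deriv {G G' : ℝ → ℝ} {t : ℝ} (ht : 0 ≤ t)
    (hG : ∀ s, HasDerivAt G (-(G' s)) s) (hG' : Continuous G')
    (hpos : ∀ s ∈ Set.Icc 0 t, 0 ≤ G' s) (hGt : 0 ≤ G t) :
    ENNReal.ofReal (G t) + ∫⁻ s in Set.Icc 0 t, ENNReal.ofReal (G' s) = ENNReal.ofReal (G 0) := by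
  have h := intervalIntegral.integral_eq_sub_of_hasDerivAt (a := 0) (b := t) (fun s _ => hG s)
    (hG'.neg.intervalIntegrable _ _)
  rw [intervalIntegral.integral_neg] at h
  rw [← ofReal_integral_eq_lintegral_ofReal (hG'.continuousOn.integrableOn_Icc)
    ((ae_restrict_iff' measurableSet_Icc).mpr (ae_of_all _ hpos)), integral_Icc_eq_integral_Ioc,
    ← intervalIntegral.integral_of_le ht,
    ← ENNReal.ofReal_add hGt (intervalIntegral.integral_nonneg ht hpos)]
  congr 1
  linarith

/-- There is either no jump or a first jump. -/
lemma ofReal_add_lintegral_jumpDensity (t y : ℝ≥0) :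
    ENNReal.ofReal (Real.exp (-hazard pA pB g t y)) +
      ∫⁻ s in Set.Icc (0 : ℝ) t, ENNReal.ofReal (jumpDensity pA pB g s y) = 1 := by
  have h := ofReal_add_lintegral_neg_deriv (G := fun s => Real.exp (-hazard pA pB g s y))
    (G' := fun s => jumpDensity pA pB g s y) t.coe_nonneg (fun s => ?_)
    (by fun_prop) (fun s hs => jumpDensity_nonneg hp hs.1 y.coe_nonneg) (Real.exp_pos _).le
  · rw [h, hazard_zero, neg_zero, Real.exp_zero, ENNReal.ofReal_one]
  · refine ((hasDerivAt_hazard hp s y).neg.exp).congr_deriv ?_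
    simp only [jumpDensity, Pi.neg_apply]
    ring

lemma continuous_psi (θ : ℝ) : Continuous fun t => psi hp t θ :=
  continuous_iff_continuousAt.mpr fun t => (hasDerivAt_psi hp t θ).continuousAt

lemma continuous_immigration_psi (θ : ℝ) :
    Continuous fun t => immigration pA pB g (psi hp t θ) := by
  refine continuous_iff_continuousAt.mpr fun t => ?_
  have h : HasDerivAt (immigration pA pB g ∘ fun t => psi hp t θ) _ t :=
    (hasDerivAt_immigration hp (psi_pos hp t θ)).comp t (hasDerivAt_psi hp t θ)
  exact h.continuousAt

/-- The first-jump decomposition of `laplaceSol`. -/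
lemma ofReal_add_lintegral_laplaceSol (θ : ℝ) (t y : ℝ≥0) :
    ENNReal.ofReal (Real.exp (-hazard pA pB g t y) * laplaceSol hp θ 0 (flow pA t y)) +
      ∫⁻ s in Set.Icc (0 : ℝ) t, ENNReal.ofReal (jumpDensity pA pB g s y) *
        ENNReal.ofReal (laplaceSol hp θ (t - s) (flow pA s y + g)) =
      ENNReal.ofReal (laplaceSol hp θ t y) := by
  have hcψ := continuous_psi hp θ
  have hcB := continuous_immigration_psi hp θ
  have h := ofReal_add_lintegral_neg_deriv
    (G := fun s => Real.exp (-hazard pA pB g s y) * laplaceSol hp θ (t - s) (flow pA s y))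
    (G' := fun s => jumpDensity pA pB g s y * laplaceSol hp θ (t - s) (flow pA s y + g))
    t.coe_nonneg (fun s => ?_) ?_ (fun s hs => mul_nonneg
      (jumpDensity_nonneg hp hs.1 y.coe_nonneg) (laplaceSol_pos hp _ _ _).le)
    (mul_nonneg (Real.exp_pos _).le (laplaceSol_pos hp _ _ _).le)
  · rw [hazard_zero, flow_zero, sub_self, sub_zero, neg_zero, Real.exp_zero, one_mul] at h
    rw [← h]
    congr 1
    refine setLIntegral_congr_fun measurableSet_Icc fun s hs => ?_
    exact (ENNReal.ofReal_mul (jumpDensity_nonneg hp hs.1 y.coe_nonneg)).symm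
  · have h1 := (hasDerivAt_hazard hp s y).neg.exp
    have h2 : HasDerivAt (fun s => psi hp (t - s) θ)
        (-branching pA pB g (psi hp (t - s) θ) * -1) s :=
      (hasDerivAt_psi hp (t - s) θ).comp s ((hasDerivAt_id s).const_sub _)
    have h3 := (hasDerivAt_immigration hp (psi_pos hp (t - s) θ)).comp s h2
    have h4 := ((h3.const_add (-(immigration pA pB g θ))).sub (h2.mul (hasDerivAt_flow hp s y))).exp
    refine (h1.mul h4).congr_deriv ?_
    have hs : laplaceSol hp θ (t - s) (flow pA s y + g) =
        laplaceSol hp θ (t - s) (flow pA s y) * Real.exp (-(g * psi hp (t - s) θ)) := by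
      rw [laplaceSol, laplaceSol, ← Real.exp_add]
      congr 1
      ring
    have hne := (branching_pos hp (psi_pos hp (t - s) θ)).ne'
    have hR : branching pA pB g (psi hp (t - s) θ) = pA * psi hp (t - s) θ -
      pB / g * (1 - Real.exp (-(g * psi hp (t - s) θ))) := rfl
    have hB : (1 - pA) * (psi hp (t - s) θ / branching pA pB g (psi hp (t - s) θ)) *
        (-branching pA pB g (psi hp (t - s) θ) * -1) = (1 - pA) * psi hp (t - s) θ := by
      field_simp
    rw [hB, hs, jumpDensity, hR]
    simp only [laplaceSol, Pi.neg_apply, Pi.sub_apply, Pi.mul_apply, Function.comp]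
    ring_nf
  · unfold laplaceSol
    have : Continuous fun s : ℝ => (t : ℝ) - s := by fun_prop
    have h1 := hcψ.comp this
    have h2 := hcB.comp this
    simp only [Function.comp_def] at h1 h2
    fun_prop

omit hp in
/-- The law at time `t` of the process started at `y`, on the event that there is no jump before
time `t`; as a kernel in `(t, y)`. -/
noncomputable def noJumpKernel (pA pB g : ℝ) : Kernel (ℝ≥0 × ℝ≥0) ℝ≥0 :=
  Kernel.withDensity (Kernel.deterministic (fun x : ℝ≥0 × ℝ≥0 => (flow pA x.1 x.2).toNNReal)
      (by fun_prop))
    (fun x _ => ENNReal.ofReal (Real.exp (-hazard pA pB g x.1 x.2)))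

omit hp in
/-- The joint law, for the process run for time `t` from `y`, of the time left after the first jump
and the position after it, on the event that there is a jump; as a kernel in `(t, y)`. -/
noncomputable def firstJumpKernel (pA pB g : ℝ) : Kernel (ℝ≥0 × ℝ≥0) (ℝ≥0 × ℝ≥0) :=
  (Kernel.id ×ₖ Kernel.withDensity (Kernel.const (ℝ≥0 × ℝ≥0) (volume : Measure ℝ))
      (fun x s => ((Set.indicator {q : (ℝ≥0 × ℝ≥0) × ℝ | q.2 ∈ Set.Icc (0 : ℝ) q.1.1}
        (fun q => (jumpDensity pA pB g q.2 q.1.2).toNNReal) (x, s) : ℝ≥0) : ℝ≥0∞))).map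
    fun q => (((q.1.1 : ℝ) - q.2).toNNReal, (flow pA q.2 q.1.2 + g).toNNReal)

omit hp in
lemma lintegral_noJumpKernel (x : ℝ≥0 × ℝ≥0) {f : ℝ≥0 → ℝ≥0∞} (hf : Measurable f) :
    ∫⁻ z, f z ∂(noJumpKernel pA pB g x) =
      ENNReal.ofReal (Real.exp (-hazard pA pB g x.1 x.2)) * f (flow pA x.1 x.2).toNNReal := by
  rw [noJumpKernel, Kernel.lintegral_withDensity _ (by fun_prop) _ hf,
    Kernel.lintegral_deterministic' _ (by fun_prop)]

omit hp in
lemma lintegral_firstJumpKernel (x : ℝ≥0 × ℝ≥0) {f : ℝ≥0 × ℝ≥0 → ℝ≥0∞} (hf : Measurable f) :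
    ∫⁻ z, f z ∂(firstJumpKernel pA pB g x) =
      ∫⁻ s in Set.Icc (0 : ℝ) x.1, ENNReal.ofReal (jumpDensity pA pB g s x.2) *
        f (((x.1 : ℝ) - s).toNNReal, (flow pA s x.2 + g).toNNReal) := by
  have hset : MeasurableSet {q : (ℝ≥0 × ℝ≥0) × ℝ | q.2 ∈ Set.Icc (0 : ℝ) q.1.1} := by
    have h1 : MeasurableSet {q : (ℝ≥0 × ℝ≥0) × ℝ | (0 : ℝ) ≤ q.2} :=
      measurableSet_le measurable_const measurable_snd
    have h2 : MeasurableSet {q : (ℝ≥0 × ℝ≥0) × ℝ | q.2 ≤ (q.1.1 : ℝ)} :=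
      measurableSet_le measurable_snd (by fun_prop)
    exact h1.inter h2
  have hm : Measurable fun q : (ℝ≥0 × ℝ≥0) × ℝ =>
      (((q.1.1 : ℝ) - q.2).toNNReal, (flow pA q.2 q.1.2 + g).toNNReal) := by fun_prop
  have hd : Measurable (Set.indicator {q : (ℝ≥0 × ℝ≥0) × ℝ | q.2 ∈ Set.Icc (0 : ℝ) q.1.1}
        (fun q => (jumpDensity pA pB g q.2 q.1.2).toNNReal)) :=
    Measurable.indicator (by fun_prop) hset
  rw [firstJumpKernel, Kernel.lintegral_map _ hm _ hf, Kernel.lintegral_id_prod (f := fun q => f _) (hf.comp hm),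
    Kernel.lintegral_withDensity _ ?_ _ ?_, Kernel.const_apply, ← lintegral_indicator
    measurableSet_Icc]
  · refine lintegral_congr fun s => ?_
    by_cases hs : s ∈ Set.Icc (0 : ℝ) x.1
    · rw [Set.indicator_of_mem hs, Set.indicator_of_mem (by exact hs)]
      rfl
    · rw [Set.indicator_of_notMem hs, Set.indicator_of_notMem (by exact hs)]
      simp
  · exact measurable_coe_nnreal_ennreal.comp hd
  · exact (hf.comp hm).comp measurable_prodMk_left

omit hp in
/-- The law at time `t` of the process started at `y`, on the event that there are exactly `n`
jumps before time `t`; as a kernel in `(t, y)`. -/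
noncomputable def jumpCountKernel (pA pB g : ℝ) : ℕ → Kernel (ℝ≥0 × ℝ≥0) ℝ≥0
  | 0 => noJumpKernel pA pB g
  | n + 1 => jumpCountKernel pA pB g n ∘ₖ firstJumpKernel pA pB g

omit hp in
/-- The law at time `t` of the process started at `y`; as a kernel in `(t, y)`. -/
noncomputable def transitionKernel (pA pB g : ℝ) : Kernel (ℝ≥0 × ℝ≥0) ℝ≥0 :=
  Kernel.sum (jumpCountKernel pA pB g)

omit hp in
lemma lintegral_transitionKernel (x : ℝ≥0 × ℝ≥0) (f : ℝ≥0 → ℝ≥0∞) :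
    ∫⁻ z, f z ∂(transitionKernel pA pB g x) = ∑' n, ∫⁻ z, f z ∂(jumpCountKernel pA pB g n x) := by
  rw [transitionKernel, Kernel.sum_apply, lintegral_sum_measure]

omit hp in
lemma sum_lintegral_jumpCountKernel_succ (x : ℝ≥0 × ℝ≥0) {f : ℝ≥0 → ℝ≥0∞} (hf : Measurable f)
    (n : ℕ) : ∑ k ∈ Finset.range (n + 1), ∫⁻ z, f z ∂(jumpCountKernel pA pB g k x) =
      ∫⁻ z, f z ∂(noJumpKernel pA pB g x) +
        ∫⁻ x', ∑ k ∈ Finset.range n, ∫⁻ z, f z ∂(jumpCountKernel pA pB g k x')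
          ∂(firstJumpKernel pA pB g x) := by
  rw [Finset.sum_range_succ', add_comm, lintegral_finsetSum _ fun k _ => hf.lintegral_kernel]
  congr 1
  refine Finset.sum_congr rfl fun k _ => ?_
  rw [jumpCountKernel, Kernel.lintegral_comp _ _ _ hf]

omit hp in
/-- Minimality: the law of the process is dominated by supersolutions of the first-jump
equation. -/
lemma lintegral_transitionKernel_le {f : ℝ≥0 → ℝ≥0∞} (hf : Measurable f) {u : ℝ≥0 × ℝ≥0 → ℝ≥0∞}
    (hu : ∀ x, ∫⁻ z, f z ∂(noJumpKernel pA pB g x) + ∫⁻ x', u x' ∂(firstJumpKernel pA pB g x) ≤ u x)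
    (x : ℝ≥0 × ℝ≥0) : ∫⁻ z, f z ∂(transitionKernel pA pB g x) ≤ u x := by
  have h : ∀ n x, ∑ k ∈ Finset.range n, ∫⁻ z, f z ∂(jumpCountKernel pA pB g k x) ≤ u x := by
    intro n
    induction n with
    | zero => simp
    | succ n ih =>
      intro x
      rw [sum_lintegral_jumpCountKernel_succ x hf]
      exact (add_le_add le_rfl (lintegral_mono ih)).trans (hu x)
  rw [lintegral_transitionKernel]
  exact ENNReal.tsum_le_of_sum_range_le fun n => h n x

omit hp in
/-- The law of the process dominates a subsolution `u` of the first-jump equation, as soon as the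
iterates of the first-jump kernel on `u` tend to `0`. -/
lemma le_lintegral_transitionKernel {f : ℝ≥0 → ℝ≥0∞} (hf : Measurable f) {u : ℝ≥0 × ℝ≥0 → ℝ≥0∞}
    {w : ℕ → ℝ≥0 × ℝ≥0 → ℝ≥0∞}
    (hu : ∀ x, u x ≤ ∫⁻ z, f z ∂(noJumpKernel pA pB g x) + ∫⁻ x', u x' ∂(firstJumpKernel pA pB g x))
    (huw : ∀ x, u x ≤ w 0 x) (hw : ∀ n x, ∫⁻ x', w n x' ∂(firstJumpKernel pA pB g x) ≤ w (n + 1) x)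
    (hw0 : ∀ x, Tendsto (fun n => w n x) atTop (𝓝 0)) (x : ℝ≥0 × ℝ≥0) :
    u x ≤ ∫⁻ z, f z ∂(transitionKernel pA pB g x) := by
  have h : ∀ n x, u x ≤
      ∑ k ∈ Finset.range n, ∫⁻ z, f z ∂(jumpCountKernel pA pB g k x) + w n x := by
    intro n
    induction n with
    | zero => simpa using huw
    | succ n ih =>
      intro x
      rw [sum_lintegral_jumpCountKernel_succ x hf, add_assoc]
      refine (hu x).trans (add_le_add le_rfl ((lintegral_mono ih).trans ?_))
      rw [lintegral_add_left (Finset.measurable_fun_sum _ fun k _ => hf.lintegral_kernel)]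
      exact add_le_add le_rfl (hw n x)
  rw [lintegral_transitionKernel]
  have h2 := (ENNReal.tendsto_nat_tsum fun n =>
    ∫⁻ z, f z ∂(jumpCountKernel pA pB g n x)).add (hw0 x)
  rw [add_zero] at h2
  exact ge_of_tendsto' h2 fun n => h n x

omit hp in
lemma lintegral_firstJumpKernel_le {f : ℝ≥0 × ℝ≥0 → ℝ≥0∞} (hf : Measurable f) {c : ℝ≥0∞}
    (x : ℝ≥0 × ℝ≥0) (h : ∀ s ∈ Set.Icc (0 : ℝ) x.1,
      f (((x.1 : ℝ) - s).toNNReal, (flow pA s x.2 + g).toNNReal) ≤ c) :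
    ∫⁻ z, f z ∂(firstJumpKernel pA pB g x) ≤
      (∫⁻ s in Set.Icc (0 : ℝ) x.1, ENNReal.ofReal (jumpDensity pA pB g s x.2)) * c := by
  rw [lintegral_firstJumpKernel x hf, ← lintegral_mul_const _ (by fun_prop)]
  exact setLIntegral_mono' measurableSet_Icc fun s hs => mul_le_mul_right (h s hs) _

lemma transitionKernel_univ_le (x : ℝ≥0 × ℝ≥0) : transitionKernel pA pB g x Set.univ ≤ 1 := by
  have h := lintegral_transitionKernel_le (pA := pA) (pB := pB) (g := g) (f := fun _ => 1)
    measurable_const (u := fun _ => 1) (fun x => ?_) x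
  · simpa using h
  · rw [lintegral_noJumpKernel x measurable_const]
    refine (add_le_add le_rfl (lintegral_firstJumpKernel_le measurable_const x
      fun s _ => le_rfl)).trans ?_
    rw [mul_one, mul_one, ofReal_add_lintegral_jumpDensity hp]

lemma measurable_laplaceSol (θ : ℝ) :
    Measurable fun x : ℝ≥0 × ℝ≥0 => laplaceSol hp θ x.1 x.2 := by
  have hcψ := continuous_psi hp θ
  have hcB := continuous_immigration_psi hp θ
  have hfst : Measurable fun x : ℝ≥0 × ℝ≥0 => (x.1 : ℝ) := by fun_prop
  have hsnd : Measurable fun x : ℝ≥0 × ℝ≥0 => (x.2 : ℝ) := by fun_prop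
  exact Real.measurable_exp.comp ((measurable_const.add (hcB.measurable.comp hfst)).sub
    ((hcψ.measurable.comp hfst).mul hsnd))

/-- The Laplace transform of the constructed process. -/
lemma lintegral_exp_transitionKernel {θ : ℝ} (hθ : 0 < θ) (x : ℝ≥0 × ℝ≥0) :
    ∫⁻ z : ℝ≥0, ENNReal.ofReal (Real.exp (-(θ * z))) ∂(transitionKernel pA pB g x) =
      ENNReal.ofReal (laplaceSol hp θ x.1 x.2) := by
  have hf : Measurable fun z : ℝ≥0 => ENNReal.ofReal (Real.exp (-(θ * z))) := by fun_prop
  have hum : Measurable fun x : ℝ≥0 × ℝ≥0 => ENNReal.ofReal (laplaceSol hp θ x.1 x.2) :=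
    ENNReal.measurable_ofReal.comp (measurable_laplaceSol hp θ)
  have hg := hp.g_pos
  -- `laplaceSol` solves the first-jump equation
  have heq : ∀ x : ℝ≥0 × ℝ≥0,
      ∫⁻ z : ℝ≥0, ENNReal.ofReal (Real.exp (-(θ * z))) ∂(noJumpKernel pA pB g x) +
        ∫⁻ x', ENNReal.ofReal (laplaceSol hp θ x'.1 x'.2) ∂(firstJumpKernel pA pB g x) =
      ENNReal.ofReal (laplaceSol hp θ x.1 x.2) := by
    intro x
    have h1 : 0 ≤ flow pA x.1 x.2 := flow_nonneg hp x.1.coe_nonneg x.2.coe_nonneg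
    rw [lintegral_noJumpKernel x hf, lintegral_firstJumpKernel x hum, Real.coe_toNNReal _ h1,
      ← laplaceSol_zero hp hθ, ← ENNReal.ofReal_mul (Real.exp_pos _).le,
      ← ofReal_add_lintegral_laplaceSol]
    congr 1
    refine setLIntegral_congr_fun measurableSet_Icc fun s hs => ?_
    have h3 := flow_nonneg hp hs.1 x.2.coe_nonneg
    simp only
    rw [Real.coe_toNNReal _ (sub_nonneg.mpr hs.2), Real.coe_toNNReal _ (by linarith)]
  refine le_antisymm (lintegral_transitionKernel_le hf
    (u := fun x => ENNReal.ofReal (laplaceSol hp θ x.1 x.2)) (fun x => (heq x).le) x) ?_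
  -- each jump raises the position by `g`, which makes the iterates small
  refine le_lintegral_transitionKernel hf
    (u := fun x => ENNReal.ofReal (laplaceSol hp θ x.1 x.2))
    (w := fun n x => ENNReal.ofReal
      (Real.exp (-(θ * Real.exp (-(pA * x.1)) * (x.2 + n * g))))) (fun x => (heq x).ge) ?_ ?_ ?_ x
  · intro x
    refine ENNReal.ofReal_le_ofReal ?_
    simpa using laplaceSol_le hp hθ x.1.coe_nonneg le_rfl x.2.coe_nonneg
  · intro n x
    refine (lintegral_firstJumpKernel_le (by fun_prop) x
      (c := ENNReal.ofReal (Real.exp (-(θ * Real.exp (-(pA * x.1)) * (x.2 + (n + 1 : ℕ) * g)))))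
      fun s hs => ?_).trans ?_
    · refine ENNReal.ofReal_le_ofReal (Real.exp_le_exp.mpr (neg_le_neg ?_))
      have h3 := flow_nonneg hp hs.1 x.2.coe_nonneg
      rw [Real.coe_toNNReal _ (sub_nonneg.mpr hs.2), Real.coe_toNNReal _ (by linarith), mul_assoc,
        mul_assoc]
      refine mul_le_mul_of_nonneg_left ?_ hθ.le
      have h5 : Real.exp (-(pA * (x.1 - s))) * Real.exp (-(pA * s)) = Real.exp (-(pA * x.1)) := by
        rw [← Real.exp_add]
        congr 1
        ring
      have h6 : Real.exp (-(pA * x.1)) ≤ Real.exp (-(pA * (x.1 - s))) := by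
        rw [Real.exp_le_exp]
        have := mul_nonneg hp.pA_pos.le hs.1
        linarith
      have h7 := mul_le_mul_of_nonneg_left (mul_exp_le_flow hp (y := x.2) hs.1)
        (Real.exp_pos (-(pA * (x.1 - s)))).le
      have h8 : Real.exp (-(pA * (x.1 - s))) * (x.2 * Real.exp (-(pA * s))) =
          Real.exp (-(pA * x.1)) * x.2 := by rw [← h5]; ring
      have h9 : Real.exp (-(pA * x.1)) * (((n + 1 : ℕ) : ℝ) * g) ≤
          Real.exp (-(pA * (x.1 - s))) * (((n + 1 : ℕ) : ℝ) * g) :=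
        mul_le_mul_of_nonneg_right h6 (by positivity)
      push_cast at h9 ⊢
      linarith
    · refine mul_le_of_le_one_left zero_le ?_
      rw [← ofReal_add_lintegral_jumpDensity hp x.1 x.2]
      exact le_add_self
  · intro x
    rw [← ENNReal.ofReal_zero]
    refine ENNReal.tendsto_ofReal ?_
    refine Real.tendsto_exp_neg_atTop_nhds_zero.comp ?_
    refine Tendsto.const_mul_atTop (mul_pos hθ (Real.exp_pos _)) ?_
    exact tendsto_atTop_add_const_left _ _ (tendsto_natCast_atTop_atTop.atTop_mul_const hg)

end

/-! ### Existence of the semigroup -/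

section
variable {pA pB g : ℝ} (hp : Admissible pA pB g)
include hp

lemma laplaceSol_le_one {θ t y : ℝ} (hθ : 0 < θ) (ht : 0 ≤ t) (hy : 0 ≤ y) :
    laplaceSol hp θ t y ≤ 1 := by
  refine (laplaceSol_le_exp hp hθ ht).trans (Real.exp_le_one_iff.mpr ?_)
  linarith [mul_nonneg (psi_pos hp t θ).le hy]

lemma exp_le_laplaceSol {θ t y : ℝ} (hθ : 0 < θ) (ht : 0 ≤ t) (hy : 0 ≤ y) :
    Real.exp (-(((1 - pA) / (pA - pB) + y) * θ)) ≤ laplaceSol hp θ t y := by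
  refine Real.exp_le_exp.mpr ?_
  have h1 := immigration_le hp hθ.le
  have h2 := immigration_nonneg hp (psi_pos hp t θ).le
  have h3 := mul_le_mul_of_nonneg_right (psi_le_self hp ht hθ) hy
  linarith

omit hp in
lemma tendsto_exp_neg_const_mul_zero (c : ℝ) :
    Tendsto (fun θ : ℝ => Real.exp (-(c * θ))) (𝓝[>] 0) (𝓝 1) := by
  have : Continuous fun θ : ℝ => Real.exp (-(c * θ)) := by fun_prop
  simpa using (this.tendsto 0).mono_left nhdsWithin_le_nhds

lemma isFiniteMeasure_transitionKernel (x : ℝ≥0 × ℝ≥0) :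
    IsFiniteMeasure (transitionKernel pA pB g x) :=
  ⟨(transitionKernel_univ_le hp x).trans_lt ENNReal.one_lt_top⟩

lemma integral_exp_transitionKernel {θ : ℝ} (hθ : 0 < θ) (x : ℝ≥0 × ℝ≥0) :
    ∫ z : ℝ≥0, Real.exp (-(θ * z)) ∂(transitionKernel pA pB g x) = laplaceSol hp θ x.1 x.2 := by
  rw [integral_eq_lintegral_of_nonneg_ae (ae_of_all _ fun z => (Real.exp_pos _).le)
    (measurable_exp_neg_mul θ).aestronglyMeasurable, lintegral_exp_transitionKernel hp hθ,
    ENNReal.toReal_ofReal (laplaceSol_pos hp _ _ _).le]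

/-- The process does not explode. -/
lemma isMarkovKernel_transitionKernel : IsMarkovKernel (transitionKernel pA pB g) := by
  refine ⟨fun x => ?_⟩
  have := isFiniteMeasure_transitionKernel hp x
  have h1 : Tendsto (fun θ : ℝ => ∫ z : ℝ≥0, Real.exp (-(θ * z)) ∂(transitionKernel pA pB g x))
      (𝓝[>] 0) (𝓝 1) := by
    refine tendsto_of_tendsto_of_tendsto_of_le_of_le'
      (tendsto_exp_neg_const_mul_zero ((1 - pA) / (pA - pB) + x.2)) tendsto_const_nhds ?_ ?_
    · filter_upwards [self_mem_nhdsWithin] with θ hθ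
      rw [integral_exp_transitionKernel hp hθ]
      exact exp_le_laplaceSol hp hθ x.1.coe_nonneg x.2.coe_nonneg
    · filter_upwards [self_mem_nhdsWithin] with θ hθ
      rw [integral_exp_transitionKernel hp hθ]
      exact laplaceSol_le_one hp hθ x.1.coe_nonneg x.2.coe_nonneg
  have h2 := tendsto_nhds_unique (tendsto_laplace_zero _) h1
  exact isProbabilityMeasure_iff_real.mpr h2

omit hp in
/-- The transition semigroup of the constructed process. -/
noncomputable def transition (pA pB g : ℝ) (t : ℝ≥0) : Kernel ℝ≥0 ℝ≥0 :=
  (transitionKernel pA pB g).comap (fun y => (t, y)) (by fun_prop)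

lemma isMarkovKernel_transition (t : ℝ≥0) : IsMarkovKernel (transition pA pB g t) := by
  have := isMarkovKernel_transitionKernel hp
  unfold transition
  infer_instance

lemma integral_exp_transition {θ : ℝ} (hθ : 0 < θ) (t y : ℝ≥0) :
    ∫ z : ℝ≥0, Real.exp (-(θ * z)) ∂(transition pA pB g t y) = laplaceSol hp θ t y := by
  rw [transition, Kernel.comap_apply]
  exact integral_exp_transitionKernel hp hθ (t, y)

omit hp in
lemma integral_dirac_exp (θ : ℝ) (y : ℝ≥0) :
    ∫ z : ℝ≥0, Real.exp (-(θ * z)) ∂(Measure.dirac y) = Real.exp (-(θ * y)) :=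
  integral_dirac' _ _ (measurable_exp_neg_mul θ).stronglyMeasurable

/-- The Chapman-Kolmogorov equations, which hold because they hold for Laplace transforms. -/
lemma isTransitionSemigroup_transition : IsTransitionSemigroup (transition pA pB g) := by
  have hM := isMarkovKernel_transition hp
  refine ⟨hM, ?_, fun s t => ?_⟩
  · ext1 y
    rw [Kernel.id_apply]
    refine ext_of_laplace fun θ hθ => ?_
    rw [integral_exp_transition hp hθ, integral_dirac_exp, NNReal.coe_zero, laplaceSol_zero hp hθ]
  · ext1 y
    refine ext_of_laplace fun θ hθ => ?_
    rw [integral_exp_transition hp hθ, Kernel.integral_comp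
      (integrable_exp_neg_mul _ hθ.le), NNReal.coe_add, laplaceSol_add,
      ← integral_exp_transition hp (psi_pos hp t θ), ← integral_const_mul]
    refine integral_congr_ae (ae_of_all _ fun x => ?_)
    simp only
    rw [integral_exp_transition hp hθ, laplaceSol, ← Real.exp_add, sub_eq_add_neg]

lemma isGen_exp_transition {θ : ℝ} (hθ : 0 < θ) :
    IsGen (transition pA pB g) (fun y => Real.exp (-(θ * y)))
      (generatorL pA pB g fun y => Real.exp (-(θ * y))) := by
  refine ⟨measurable_exp_neg_mul θ, ⟨1, fun y => abs_exp_neg_mul_le hθ.le y⟩, ?_⟩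
  have h0 : laplaceSol hp θ 0 = fun y => Real.exp (-(θ * y)) :=
    funext fun y => laplaceSol_zero hp hθ y
  convert tendstoUniformly_laplaceSol_zero hp hθ using 1
  · ext t y
    rw [integral_exp_transition hp hθ, h0]
  · ext y
    rw [← h0, generatorL_laplaceSol]

lemma isMarkovSemigroupWithGeneratorL_transition :
    IsMarkovSemigroupWithGeneratorL pA pB g (transition pA pB g) :=
  ⟨isTransitionSemigroup_transition hp, fun _ hf hfc =>
    (isGen_of_exp hp (isTransitionSemigroup_transition hp)
      (fun _ hθ => isGen_exp_transition hp hθ) hf hfc).tendsto⟩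

end

/-! ### The stationary distribution -/

section
variable {pA pB g : ℝ} (hp : Admissible pA pB g)
include hp

/-- The Laplace transforms converge as time tends to infinity, uniformly over bounded sets of
initial points. -/
lemma tendsto_laplaceSol {θ : ℝ} (hθ : 0 < θ) {ι : Type*} {l : Filter ι} {t y : ι → ℝ} {M : ℝ}
    (ht : Tendsto t l atTop) (hy : ∀ i, 0 ≤ y i) (hyM : ∀ i, y i ≤ M) :
    Tendsto (fun i => laplaceSol hp θ (t i) (y i)) l
      (𝓝 (Real.exp (-(immigration pA pB g θ)))) := by
  have h1 := (tendsto_psi hp hθ).comp ht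
  have h2 : Tendsto (fun i => immigration pA pB g (psi hp (t i) θ)) l (𝓝 0) :=
    (tendsto_immigration_zero hp).comp h1
  have h3 : Tendsto (fun i => psi hp (t i) θ * y i) l (𝓝 0) := by
    refine squeeze_zero (fun i => mul_nonneg (psi_pos hp _ _).le (hy i))
      (fun i => mul_le_mul_of_nonneg_left (hyM i) (psi_pos hp _ _).le) ?_
    simpa using (h1.mono_right nhdsWithin_le_nhds).mul_const M
  have h4 := (h2.const_add (-(immigration pA pB g θ))).sub h3
  rw [add_zero, sub_zero] at h4
  exact (Real.continuous_exp.tendsto _).comp h4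

variable {Q : ℝ≥0 → Kernel ℝ≥0 ℝ≥0} (hQ : IsMarkovSemigroupWithGeneratorL pA pB g Q)
include hQ

/-- The laws of the process started in `[0, M]`, at all times, form a tight family. -/
lemma isTightMeasureSet_transition (M : ℝ≥0) :
    IsTightMeasureSet {Q q.1 (min q.2 M) | q : ℝ≥0 × ℝ≥0} := by
  have := hQ.isMarkov
  refine isTightMeasureSet_of_laplace (μ := fun q : ℝ≥0 × ℝ≥0 => Q q.1 (min q.2 M))
    (tendsto_exp_neg_const_mul_zero ((1 - pA) / (pA - pB) + M)) fun q θ hθ => ?_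
  rw [hQ.laplace_eq hp hθ]
  refine le_trans (Real.exp_le_exp.mpr ?_)
    (exp_le_laplaceSol hp hθ q.1.coe_nonneg (min q.2 M).coe_nonneg)
  have h1 : ((min q.2 M : ℝ≥0) : ℝ) ≤ M := by exact_mod_cast min_le_right q.2 M
  have h2 := mul_le_mul_of_nonneg_right h1 hθ.le
  linarith

lemma exists_laplace_eq_exp_neg_immigration : ∃ ν : ProbabilityMeasure ℝ≥0, ∀ θ : ℝ, 0 < θ →
    ∫ z : ℝ≥0, Real.exp (-(θ * z)) ∂(ν : Measure ℝ≥0) = Real.exp (-(immigration pA pB g θ)) := by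
  have hM := hQ.isMarkov
  let μ : ℝ≥0 → ProbabilityMeasure ℝ≥0 := fun t => ⟨Q t 0, inferInstance⟩
  have htight : IsTightMeasureSet {((m : ProbabilityMeasure ℝ≥0) : Measure ℝ≥0) |
      m ∈ Set.range μ} := by
    refine (isTightMeasureSet_transition hp hQ 0).subset ?_
    rintro _ ⟨_, ⟨t, rfl⟩, rfl⟩
    exact ⟨(t, 0), by simp [μ]⟩
  let U : Ultrafilter ℝ≥0 := Ultrafilter.of atTop
  have hU : (U : Filter ℝ≥0) ≤ atTop := Ultrafilter.of_le _
  obtain ⟨ν, -, hν⟩ := (isCompact_closure_of_isTightMeasureSet htight).ultrafilter_le_nhds (U.map μ)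
    (by
      refine le_trans ?_ (principal_mono.mpr subset_closure)
      simp)
  have hν' : Tendsto μ U (𝓝 ν) := hν
  refine ⟨ν, fun θ hθ => ?_⟩
  let u : ℝ≥0 →ᵇ ℝ := BoundedContinuousFunction.ofNormedAddCommGroup
    (fun z : ℝ≥0 => Real.exp (-(θ * z))) (by fun_prop) 1 (fun z => abs_exp_neg_mul_le hθ.le z)
  have h1 := ProbabilityMeasure.tendsto_iff_forall_integral_tendsto.mp hν' u
  have h2 : Tendsto (fun t : ℝ≥0 => laplaceSol hp θ t 0) U
      (𝓝 (Real.exp (-(immigration pA pB g θ)))) :=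
    tendsto_laplaceSol hp hθ (y := fun _ => 0) (M := 0)
      (NNReal.tendsto_coe_atTop.mpr (tendsto_id.mono_left hU)) (fun _ => le_rfl) fun _ => le_rfl
  refine tendsto_nhds_unique h1 (h2.congr fun t => ?_)
  rw [← NNReal.coe_zero, ← hQ.laplace_eq hp hθ]
  rfl

lemma integral_exp_bind (ν : Measure ℝ≥0) [IsProbabilityMeasure ν] {θ : ℝ} (hθ : 0 < θ) (t : ℝ≥0) :
    ∫ z : ℝ≥0, Real.exp (-(θ * z)) ∂(ν.bind (Q t)) = ∫ y : ℝ≥0, laplaceSol hp θ t y ∂ν := by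
  have hM := hQ.isMarkov t
  have hi := integrable_exp_neg_mul (ν.bind (Q t)) hθ.le
  rw [Measure.comp_eq_comp_const_apply] at hi ⊢
  rw [Kernel.integral_comp hi, Kernel.const_apply]
  exact integral_congr_ae (ae_of_all _ fun y => hQ.laplace_eq hp hθ t y)

/-- A stationary distribution has Laplace transform `exp (-B)`. -/
lemma IsStationary.laplace_eq {ν : Measure ℝ≥0} (hν : IsStationary Q ν) {θ : ℝ} (hθ : 0 < θ) :
    ∫ z : ℝ≥0, Real.exp (-(θ * z)) ∂ν = Real.exp (-(immigration pA pB g θ)) := by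
  have hν1 := hν.1
  have h1 : Tendsto (fun t : ℝ≥0 => ∫ y : ℝ≥0, laplaceSol hp θ t y ∂ν) atTop
      (𝓝 (∫ _ : ℝ≥0, Real.exp (-(immigration pA pB g θ)) ∂ν)) := by
    have hm : ∀ t : ℝ≥0, Measurable fun y : ℝ≥0 => laplaceSol hp θ t y := fun t => by
      unfold laplaceSol
      fun_prop
    refine tendsto_integral_filter_of_dominated_convergence
      (F := fun (t : ℝ≥0) (y : ℝ≥0) => laplaceSol hp θ t y)
      (f := fun _ => Real.exp (-(immigration pA pB g θ))) (fun _ => 1) ?_ ?_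
      (integrable_const _) ?_
    · exact Eventually.of_forall fun t => (hm t).aestronglyMeasurable
    · refine Eventually.of_forall fun t => ae_of_all _ fun y => ?_
      rw [Real.norm_of_nonneg (laplaceSol_pos hp _ _ _).le]
      exact laplaceSol_le_one hp hθ t.coe_nonneg y.coe_nonneg
    · refine ae_of_all _ fun y => ?_
      exact tendsto_laplaceSol hp hθ (y := fun _ => (y : ℝ)) (M := y)
        (NNReal.tendsto_coe_atTop.mpr tendsto_id) (fun _ => y.coe_nonneg) fun _ => le_rfl
  rw [integral_const, probReal_univ, one_smul] at h1
  refine tendsto_nhds_unique (Tendsto.congr (fun t => ?_) tendsto_const_nhds) h1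
  rw [← integral_exp_bind hp hQ ν hθ, (hν.2 t).def]

lemma isStationary_of_laplace_eq {ν : Measure ℝ≥0} [IsProbabilityMeasure ν]
    (hν : ∀ θ : ℝ, 0 < θ →
      ∫ z : ℝ≥0, Real.exp (-(θ * z)) ∂ν = Real.exp (-(immigration pA pB g θ))) :
    IsStationary Q ν := by
  have hM := hQ.isMarkov
  refine ⟨inferInstance, fun t => ?_⟩
  refine ext_of_laplace fun θ hθ => ?_
  have h1 : ∀ y : ℝ≥0, laplaceSol hp θ t y =
      Real.exp (-(immigration pA pB g θ) + immigration pA pB g (psi hp t θ)) *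
        Real.exp (-(psi hp t θ * y)) := fun y => by
    rw [laplaceSol, ← Real.exp_add, sub_eq_add_neg]
  rw [integral_exp_bind hp hQ ν hθ]
  simp_rw [h1]
  rw [integral_const_mul, hν _ (psi_pos hp t θ), ← Real.exp_add, hν θ hθ, add_neg_cancel_right]

/-- Convergence to the stationary distribution, uniformly over compact sets of initial points. -/
lemma tendstoUniformlyOn_of_isStationary {ν : Measure ℝ≥0} (hν : IsStationary Q ν) {K : Set ℝ≥0}
    (hK : IsCompact K) (f : ℝ≥0 →ᵇ ℝ) :
    TendstoUniformlyOn (fun (t : ℝ≥0) (y : ℝ≥0) => ∫ z, f z ∂(Q t y))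
      (fun _ => ∫ z, f z ∂ν) atTop K := by
  have hM := hQ.isMarkov
  have hν1 := hν.1
  obtain ⟨M, hKM⟩ := hK.bddAbove
  let μ : ℝ≥0 × ℝ≥0 → ProbabilityMeasure ℝ≥0 := fun q => ⟨Q q.1 (min q.2 M), inferInstance⟩
  let ν' : ProbabilityMeasure ℝ≥0 := ⟨ν, hν1⟩
  have hμ : Tendsto μ (atTop ×ˢ 𝓟 K) (𝓝 ν') := by
    refine tendsto_of_laplace (isTightMeasureSet_transition hp hQ M) fun θ hθ => ?_
    have h1 := tendsto_laplaceSol hp hθ (l := (atTop : Filter ℝ≥0) ×ˢ 𝓟 K)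
      (t := fun q => (q.1 : ℝ)) (y := fun q => ((min q.2 M : ℝ≥0) : ℝ)) (M := M)
      (NNReal.tendsto_coe_atTop.mpr tendsto_fst) (fun q => NNReal.coe_nonneg _)
      (fun q => by exact_mod_cast min_le_right q.2 M)
    rw [← hν.laplace_eq hp hQ hθ] at h1
    exact h1.congr fun q => (hQ.laplace_eq hp hθ _ _).symm
  have h2 := ProbabilityMeasure.tendsto_iff_forall_integral_tendsto.mp hμ f
  rw [tendstoUniformlyOn_iff_tendsto, ← Uniform.tendsto_nhds_right]
  refine h2.congr' ?_
  have h3 : ∀ᶠ q : ℝ≥0 × ℝ≥0 in atTop ×ˢ 𝓟 K, q.2 ∈ K :=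
    tendsto_snd.eventually (mem_principal_self K)
  filter_upwards [h3] with q hq
  have : min q.2 M = q.2 := min_eq_left (hKM hq)
  simp only [μ, ProbabilityMeasure.coe_mk, this]

end

/-! ### Regularity of solutions of the flux equation -/

/-- `φ` is a nonnegative solution, vanishing on `(-∞, r]`, of the flux equation
`(x - r) φ(x) = κ ∫ z in x - g..x, z φ(z)` on `(r, ∞)`. -/
structure IsFluxSolution (r g κ : ℝ) (φ : ℝ → ℝ) : Prop where
  nonneg : ∀ x, 0 ≤ φ x
  eq_zero : ∀ x ≤ r, φ x = 0
  eq : ∀ x, r < x → φ x = κ * (∫ z in (x - g)..x, z * φ z) / (x - r)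
  integrable : Integrable fun z => z * φ z

section
variable {r g κ : ℝ} {φ : ℝ → ℝ} (hφ : IsFluxSolution r g κ φ)
include hφ

lemma IsFluxSolution.continuous_primitive : Continuous fun x => ∫ z in r..x, z * φ z :=
  intervalIntegral.continuous_primitive (fun _ _ => hφ.integrable.intervalIntegrable) r

lemma IsFluxSolution.eq_sub {x : ℝ} (hx : r < x) :
    φ x = κ * ((∫ z in r..x, z * φ z) - ∫ z in r..(x - g), z * φ z) / (x - r) := by
  rw [hφ.eq x hx, intervalIntegral.integral_interval_sub_left
    hφ.integrable.intervalIntegrable hφ.integrable.intervalIntegrable]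

lemma IsFluxSolution.continuousOn : ContinuousOn φ (Set.Ioi r) := by
  have hG := hφ.continuous_primitive
  have h1 : ContinuousOn (fun x => κ * ((∫ z in r..x, z * φ z) - ∫ z in r..(x - g), z * φ z) /
      (x - r)) (Set.Ioi r) := by
    refine ContinuousOn.div ?_ (by fun_prop) fun x hx => (sub_pos.mpr hx).ne'
    have h2 : Continuous fun x => ∫ z in r..(x - g), z * φ z :=
      hG.comp (continuous_id.sub continuous_const)
    exact (continuous_const.mul (hG.sub h2)).continuousOn
  exact h1.congr fun x hx => hφ.eq_sub hx

lemma IsFluxSolution.mul_nonneg (hr : 0 < r) (z : ℝ) : 0 ≤ z * φ z := by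
  rcases le_or_gt z r with h | h
  · rw [hφ.eq_zero z h, mul_zero]
  · exact _root_.mul_nonneg (hr.trans h).le (hφ.nonneg z)

lemma IsFluxSolution.primitive_eq_zero {x : ℝ} (hx : x ≤ r) : ∫ z in r..x, z * φ z = 0 := by
  rw [intervalIntegral.integral_symm, neg_eq_zero]
  refine intervalIntegral.integral_zero_ae (ae_of_all _ fun z hz => ?_)
  rw [Set.uIoc_of_le hx] at hz
  rw [hφ.eq_zero z hz.2, mul_zero]

lemma IsFluxSolution.primitive_mono (hr : 0 < r) : Monotone fun x => ∫ z in r..x, z * φ z := by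
  intro a b hab
  have h1 : (∫ z in r..b, z * φ z) - ∫ z in r..a, z * φ z = ∫ z in a..b, z * φ z :=
    intervalIntegral.integral_interval_sub_left hφ.integrable.intervalIntegrable
      hφ.integrable.intervalIntegrable
  have h2 : 0 ≤ ∫ z in a..b, z * φ z :=
    intervalIntegral.integral_nonneg hab fun z _ => hφ.mul_nonneg hr z
  simp only
  linarith

/-- The mass charges every right neighbourhood of `r`: otherwise the flux equation forces it to
vanish a little further to the right of the largest interval on which it vanishes. -/
lemma IsFluxSolution.primitive_pos (hr : 0 < r) (hκ : 0 < κ) (hne : ∃ x, φ x ≠ 0) {x : ℝ}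
    (hx : r < x) : 0 < ∫ z in r..x, z * φ z := by
  set G : ℝ → ℝ := fun x => ∫ z in r..x, z * φ z with hG
  have hGm : Monotone G := hφ.primitive_mono hr
  have hGc : Continuous G := hφ.continuous_primitive
  have hG0 : ∀ y ≤ r, G y = 0 := fun y hy => hφ.primitive_eq_zero hy
  have hGnn : ∀ y, 0 ≤ G y := fun y => by
    rcases le_total y r with h | h
    · exact (hG0 y h).ge
    · exact (hG0 r le_rfl).ge.trans (hGm h)
  by_contra hcon
  have hGx : G x = 0 := le_antisymm (not_lt.mp hcon) (hGnn x)
  obtain ⟨b, hb⟩ : ∃ b, G b ≠ 0 := by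
    by_contra! hall
    obtain ⟨y, hy⟩ := hne
    rcases le_or_gt y r with h | h
    · exact hy (hφ.eq_zero y h)
    · apply hy
      rw [hφ.eq_sub h]
      have h1 := hall y
      have h2 := hall (y - g)
      simp only [hG] at h1 h2
      rw [h1, h2]
      simp
  have hbdd : BddAbove {y | G y = 0} := by
    refine ⟨b, fun y hy => ?_⟩
    by_contra hlt
    have h1 := hGm (not_le.mp hlt).le
    rw [show G y = 0 from hy] at h1
    exact hb (le_antisymm h1 (hGnn b))
  set x₁ := sSup {y | G y = 0} with hx₁
  have hGx₁ : G x₁ = 0 :=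
    (isClosed_singleton.preimage hGc).csSup_mem (s := {y | G y = 0}) ⟨x, hGx⟩ hbdd
  have hxx₁ : x ≤ x₁ := le_csSup hbdd hGx
  have hrx₁ : 0 < x₁ - r := by linarith
  set C := (x₁ + 1) * (κ / (x₁ - r)) with hC
  have hx₁0 : 0 < x₁ := by linarith
  have hC0 : 0 < C := by positivity
  set δ := min 1 (1 / (2 * C)) with hδ
  have hδ0 : 0 < δ := lt_min one_pos (by positivity)
  have hδC : C * δ ≤ 1 / 2 := by
    have h1 := mul_le_mul_of_nonneg_left (min_le_right 1 (1 / (2 * C))) hC0.le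
    have h2 : C * (1 / (2 * C)) = 1 / 2 := by field_simp
    rw [h2] at h1
    exact h1
  have h3 : G (x₁ + δ) = ∫ z in x₁..(x₁ + δ), z * φ z := by
    have h4 : G (x₁ + δ) - G x₁ = ∫ z in x₁..(x₁ + δ), z * φ z :=
      intervalIntegral.integral_interval_sub_left hφ.integrable.intervalIntegrable
        hφ.integrable.intervalIntegrable
    rw [hGx₁, sub_zero] at h4
    exact h4
  have h5 : ∫ z in x₁..(x₁ + δ), z * φ z ≤ ∫ _ in x₁..(x₁ + δ), C * G (x₁ + δ) := by
    refine intervalIntegral.integral_mono_on (by linarith) hφ.integrable.intervalIntegrable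
      (by simp) fun z hz => ?_
    have hz1 : r < z := by linarith [hz.1]
    have hzle : z ≤ x₁ + 1 := hz.2.trans (by linarith [min_le_left 1 (1 / (2 * C))])
    have h6 : G z - G (z - g) ≤ G (x₁ + δ) := by linarith [hGnn (z - g), hGm hz.2]
    have h7 : φ z ≤ κ / (x₁ - r) * G (x₁ + δ) := by
      rw [hφ.eq_sub hz1, div_mul_eq_mul_div]
      refine div_le_div₀ (by have := hGnn (x₁ + δ); positivity)
        (mul_le_mul_of_nonneg_left h6 hκ.le) hrx₁ (by linarith [hz.1])
    calc z * φ z ≤ (x₁ + 1) * (κ / (x₁ - r) * G (x₁ + δ)) :=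
          mul_le_mul hzle h7 (hφ.nonneg z) (by positivity)
      _ = C * G (x₁ + δ) := by rw [hC]; ring
  rw [← h3, intervalIntegral.integral_const, smul_eq_mul, add_sub_cancel_left] at h5
  have h8 := mul_le_mul_of_nonneg_right hδC (hGnn (x₁ + δ))
  have h9 : G (x₁ + δ) = 0 := by
    have := hGnn (x₁ + δ)
    linarith [(by ring : δ * (C * G (x₁ + δ)) = C * δ * G (x₁ + δ))]
  have h10 : x₁ + δ ≤ x₁ := le_csSup hbdd h9
  linarith

lemma IsFluxSolution.pos (hr : 0 < r) (hg : 0 < g) (hκ : 0 < κ) (hne : ∃ x, φ x ≠ 0) {x : ℝ}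
    (hx : r < x) : 0 < φ x := by
  have hpos : ∀ y, r < y → 0 < ∫ z in (y - g)..y, z * φ z → 0 < φ y := fun y hy h => by
    rw [hφ.eq y hy]
    exact div_pos (mul_pos hκ h) (sub_pos.mpr hy)
  -- positivity spreads to the right in steps of length `g / 2`
  have key : ∀ n : ℕ, ∀ y, r < y → y ≤ r + g + n * (g / 2) → 0 < φ y := by
    intro n
    induction n with
    | zero =>
      intro y hy hy'
      refine hpos y hy ?_
      have h1 := hφ.primitive_pos hr hκ hne hy
      have h2 := hφ.primitive_eq_zero (x := y - g) (by simp at hy'; linarith)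
      have h3 : (∫ z in r..y, z * φ z) - ∫ z in r..(y - g), z * φ z =
          ∫ z in (y - g)..y, z * φ z :=
        intervalIntegral.integral_interval_sub_left hφ.integrable.intervalIntegrable
          hφ.integrable.intervalIntegrable
      linarith
    | succ n ih =>
      intro y hy hy'
      rcases le_or_gt y (r + g + n * (g / 2)) with h | h
      · exact ih y hy h
      refine hpos y hy ?_
      have hn : 0 ≤ n * (g / 2) := by positivity
      push_cast at hy'
      have h1 : 0 < ∫ z in (y - g)..(y - g / 2), z * φ z := by
        refine intervalIntegral.intervalIntegral_pos_of_pos_on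
          hφ.integrable.intervalIntegrable (fun z hz => ?_) (by linarith)
        exact mul_pos (by linarith [hz.1]) (ih z (by linarith [hz.1]) (by linarith [hz.2]))
      have h2 : 0 ≤ ∫ z in (y - g / 2)..y, z * φ z :=
        intervalIntegral.integral_nonneg (by linarith) fun z _ => hφ.mul_nonneg hr z
      have h3 := intervalIntegral.integral_add_adjacent_intervals
        (hφ.integrable.intervalIntegrable (a := y - g) (b := y - g / 2))
        (hφ.integrable.intervalIntegrable (a := y - g / 2) (b := y))
      linarith
  obtain ⟨n, hn⟩ := exists_nat_ge ((x - r - g) / (g / 2))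
  rw [div_le_iff₀ (by positivity)] at hn
  exact key n x hx (by linarith)

/-- Bootstrap: away from the points `r + g n`, regularity of `φ` passes to its primitive with one
more derivative, and back to `φ` through the flux equation. -/
lemma IsFluxSolution.contDiffOn (hg : g ≠ 0) :
    ContDiffOn ℝ ∞ φ {x : ℝ | ∀ n : ℕ, x ≠ r + g * n} := by
  set U := {x : ℝ | ∀ n : ℕ, x ≠ r + g * n} with hU
  have hUo : IsOpen U := by
    have h1 : IsClosed ((fun x : ℝ => (x - r) / g) ⁻¹' Set.range ((↑) : ℕ → ℝ)) :=
      Nat.isClosedEmbedding_coe_real.isClosed_range.preimage (by fun_prop)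
    convert h1.isOpen_compl using 1
    ext x
    simp only [hU, Set.mem_ofPred_eq, Set.mem_compl_iff, Set.mem_preimage, Set.mem_range, not_exists]
    refine forall_congr' fun n => not_congr ?_
    rw [eq_div_iff hg]
    constructor <;> intro h <;> linarith
  have hUr : ∀ x ∈ U, x ≠ r := fun x hx => by simpa using hx 0
  have hUg : ∀ x ∈ U, x - g ∈ U := fun x hx n hn => hx (n + 1) (by push_cast; linarith)
  set G : ℝ → ℝ := fun x => ∫ z in r..x, z * φ z with hG
  have hφU : ∀ n : ℕ, ContDiffOn ℝ n G U → ContDiffOn ℝ n φ U := by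
    intro n hn x hx
    refine ContDiffAt.contDiffWithinAt ?_
    rcases lt_or_gt_of_ne (hUr x hx) with h | h
    · have h1 : φ =ᶠ[𝓝 x] fun _ => 0 := by
        filter_upwards [Iio_mem_nhds h] with y hy using hφ.eq_zero y (le_of_lt hy)
      exact contDiffAt_const.congr_of_eventuallyEq h1
    · have h1 : φ =ᶠ[𝓝 x] fun y => κ * (G y - G (y - g)) / (y - r) := by
        filter_upwards [Ioi_mem_nhds h] with y hy using hφ.eq_sub hy
      refine ContDiffAt.congr_of_eventuallyEq ?_ h1
      have h2 : ContDiffAt ℝ n G x := hn.contDiffAt (hUo.mem_nhds hx)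
      have h3 : ContDiffAt ℝ n G (x - g) := hn.contDiffAt (hUo.mem_nhds (hUg x hx))
      have h4 : ContDiffAt ℝ n (fun y => G (y - g)) x :=
        h3.comp x (contDiffAt_id.sub contDiffAt_const)
      exact (contDiffAt_const.mul (h2.sub h4)).div (contDiffAt_id.sub contDiffAt_const)
        (sub_pos.mpr h).ne'
  have hφc : ContinuousOn φ U := by
    have := hφU 0
    simp only [Nat.cast_zero, contDiffOn_zero] at this
    exact this hφ.continuous_primitive.continuousOn
  have hGd : ∀ x ∈ U, HasDerivAt G (x * φ x) x := by
    intro x hx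
    have hc : ContinuousOn (fun z => z * φ z) U := continuousOn_id.mul hφc
    exact intervalIntegral.integral_hasDerivAt_right hφ.integrable.intervalIntegrable
      (hc.stronglyMeasurableAtFilter hUo x hx) (hc.continuousAt (hUo.mem_nhds hx))
  have hGU : ∀ n : ℕ, ContDiffOn ℝ n G U := by
    intro n
    induction n with
    | zero =>
      simp only [Nat.cast_zero, contDiffOn_zero]
      exact hφ.continuous_primitive.continuousOn
    | succ n ih =>
      push_cast
      rw [contDiffOn_succ_iff_deriv_of_isOpen hUo]
      refine ⟨fun x hx => (hGd x hx).differentiableAt.differentiableWithinAt, by simp, ?_⟩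
      exact (contDiffOn_id.mul (hφU n ih)).congr fun x hx => (hGd x hx).deriv
  exact contDiffOn_infty.mpr fun n => hφU n (hGU n)

end

/-! ### The density of a solution of the flux equation between measures -/

/-- `∫ z in [x - g, x], z dμ`, with negative `z` not counted. -/
noncomputable def windowMoment (g : ℝ) (μ : Measure ℝ) (x : ℝ) : ℝ≥0∞ :=
  ∫⁻ z in Set.Icc (x - g) x, ENNReal.ofReal z ∂μ

/-- The flux equation `pA z μ = (1 - pA) μ + (pB / g) (∫ z in [x - g, x], z dμ) dx` for a probability
measure `μ` on `[0, ∞)` with finite mean. -/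
structure IsFluxMeasure (pA pB g : ℝ) (μ : Measure ℝ) : Prop where
  isProbabilityMeasure : IsProbabilityMeasure μ
  nonneg : μ (Set.Iio 0) = 0
  finite_mean : ∫⁻ z, ENNReal.ofReal z ∂μ ≠ ⊤
  eq : ∀ A, MeasurableSet A → ENNReal.ofReal pA * ∫⁻ z in A, ENNReal.ofReal z ∂μ =
    ENNReal.ofReal (1 - pA) * μ A + ENNReal.ofReal (pB / g) * ∫⁻ x in A, windowMoment g μ x

lemma measurable_windowMoment (g : ℝ) (μ : Measure ℝ) [SFinite μ] :
    Measurable (windowMoment g μ) := by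
  have hs : MeasurableSet {q : ℝ × ℝ | q.2 ∈ Set.Icc (q.1 - g) q.1} := by
    have h1 : MeasurableSet {q : ℝ × ℝ | q.1 - g ≤ q.2} :=
      measurableSet_le (by fun_prop) measurable_snd
    have h2 : MeasurableSet {q : ℝ × ℝ | q.2 ≤ q.1} := measurableSet_le measurable_snd measurable_fst
    exact h1.inter h2
  have h : Measurable fun q : ℝ × ℝ => Set.indicator {q : ℝ × ℝ | q.2 ∈ Set.Icc (q.1 - g) q.1}
      (fun q => ENNReal.ofReal q.2) q := Measurable.indicator (by fun_prop) hs
  convert h.lintegral_prod_right' (ν := μ) using 1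
  ext x
  rw [windowMoment, ← lintegral_indicator measurableSet_Icc]
  rfl

section
variable {pA pB g : ℝ} (hp : Admissible pA pB g) {μ : Measure ℝ} (hμ : IsFluxMeasure pA pB g μ)
include hp hμ

omit hp in
lemma IsFluxMeasure.lintegral_ne_top (A : Set ℝ) : ∫⁻ z in A, ENNReal.ofReal z ∂μ ≠ ⊤ :=
  ne_top_of_le_ne_top hμ.finite_mean (setLIntegral_le_lintegral _ _)

omit hμ in
lemma Admissible.fixedPoint_pos : 0 < (1 - pA) / pA :=
  div_pos (by linarith [hp.lt_one]) hp.pA_pos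

/-- Below the fixed point `r` of the deterministic motion the flux would be negative. -/
lemma IsFluxMeasure.measure_Iio : μ (Set.Iio ((1 - pA) / pA)) = 0 := by
  have := hμ.isProbabilityMeasure
  set r := (1 - pA) / pA with hr
  have hr0 : 0 < r := hp.fixedPoint_pos
  have hpr : 1 - pA = pA * r := by rw [hr]; field_simp [hp.pA_pos.ne']
  have h1 : ENNReal.ofReal (1 - pA) * μ (Set.Iio r) ≤
      ENNReal.ofReal pA * ∫⁻ z in Set.Iio r, ENNReal.ofReal z ∂μ := by
    rw [hμ.eq _ measurableSet_Iio]
    exact le_self_add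
  have h2 : ENNReal.ofReal r * μ (Set.Iio r) = (∫⁻ z in Set.Iio r, ENNReal.ofReal z ∂μ) +
      ∫⁻ z in Set.Iio r, ENNReal.ofReal (r - z) ∂μ := by
    rw [← lintegral_add_left (by fun_prop), ← setLIntegral_const]
    refine lintegral_congr_ae ?_
    have h3 : ∀ᵐ z ∂μ, 0 ≤ z := by
      rw [ae_iff]
      simp only [not_le]
      exact hμ.nonneg
    filter_upwards [ae_restrict_of_ae h3, ae_restrict_mem measurableSet_Iio] with z hz hzr
    rw [← ENNReal.ofReal_add hz (sub_nonneg.mpr (le_of_lt hzr))]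
    congr 1
    ring
  have hpA : ENNReal.ofReal pA ≠ 0 := by simpa using hp.pA_pos
  rw [hpr, ENNReal.ofReal_mul hp.pA_pos.le, mul_assoc, ENNReal.mul_le_mul_iff_right hpA
    ENNReal.ofReal_ne_top, h2] at h1
  have h4 : ∫⁻ z in Set.Iio r, ENNReal.ofReal (r - z) ∂μ = 0 := by
    have h5 : (∫⁻ z in Set.Iio r, ENNReal.ofReal z ∂μ) +
      ∫⁻ z in Set.Iio r, ENNReal.ofReal (r - z) ∂μ ≤
        (∫⁻ z in Set.Iio r, ENNReal.ofReal z ∂μ) + 0 := by simpa using h1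
    exact le_antisymm ((ENNReal.add_le_add_iff_left (hμ.lintegral_ne_top _)).mp h5) zero_le
  rw [lintegral_eq_zero_iff (by fun_prop)] at h4
  have h6 : ∀ᵐ z ∂(μ.restrict (Set.Iio r)), False := by
    filter_upwards [h4, ae_restrict_mem measurableSet_Iio] with z hz hzr
    simp only [Pi.zero_apply, ENNReal.ofReal_eq_zero] at hz
    linarith [Set.mem_Iio.mp hzr]
  rw [ae_iff] at h6
  simpa using h6

/-- On `(r, ∞)` the flux equation provides a density. -/
lemma IsFluxMeasure.restrict_Ioi : μ.restrict (Set.Ioi ((1 - pA) / pA)) =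
    (volume.restrict (Set.Ioi ((1 - pA) / pA))).withDensity fun x =>
      ENNReal.ofReal (pB / g) * windowMoment g μ x *
        (ENNReal.ofReal (pA * (x - (1 - pA) / pA)))⁻¹ := by
  have := hμ.isProbabilityMeasure
  set r := (1 - pA) / pA with hr
  have hpr : 1 - pA = pA * r := by rw [hr]; field_simp [hp.pA_pos.ne']
  set F : ℝ → ℝ≥0∞ := fun x => ENNReal.ofReal (pA * (x - r)) with hF
  have hFm : Measurable F := by fun_prop
  have hNm := measurable_windowMoment g μ
  have h1 : (μ.restrict (Set.Ioi r)).withDensity F = (volume.restrict (Set.Ioi r)).withDensity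
      fun x => ENNReal.ofReal (pB / g) * windowMoment g μ x := by
    ext A hA
    rw [withDensity_apply _ hA, withDensity_apply _ hA, Measure.restrict_restrict hA,
      Measure.restrict_restrict hA, lintegral_const_mul _ hNm]
    have h2 := hμ.eq (A ∩ Set.Ioi r) (hA.inter measurableSet_Ioi)
    have h3 : ENNReal.ofReal pA * ∫⁻ z in A ∩ Set.Ioi r, ENNReal.ofReal z ∂μ =
        ENNReal.ofReal (1 - pA) * μ (A ∩ Set.Ioi r) + ∫⁻ z in A ∩ Set.Ioi r, F z ∂μ := by
      rw [← lintegral_const_mul _ (by fun_prop), ← setLIntegral_const,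
        ← lintegral_add_left measurable_const]
      refine setLIntegral_congr_fun (hA.inter measurableSet_Ioi) fun z hz => ?_
      have hz' : r < z := hz.2
      simp only [hF]
      rw [← ENNReal.ofReal_mul hp.pA_pos.le, ← ENNReal.ofReal_add (by linarith [hp.lt_one])
        (mul_nonneg hp.pA_pos.le (by linarith)), hpr]
      congr 1
      ring
    rw [h3] at h2
    exact (ENNReal.add_right_inj
      (ENNReal.mul_ne_top ENNReal.ofReal_ne_top (measure_ne_top _ _))).mp h2
  have h4 := withDensity_inv_same (μ := μ.restrict (Set.Ioi r)) hFm (by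
      filter_upwards [ae_restrict_mem measurableSet_Ioi] with z hz
      have hz' : r < z := hz
      simp only [hF, ne_eq, ENNReal.ofReal_eq_zero, not_le]
      exact mul_pos hp.pA_pos (by linarith)) (ae_of_all _ fun z => ENNReal.ofReal_ne_top)
  rw [← h4, h1]
  exact (withDensity_mul _ (hNm.const_mul _) hFm.inv).symm

/-- An atom at `r` would make the density `1 / (x - r)`-like to the right of `r`. -/
lemma IsFluxMeasure.measure_singleton : μ {(1 - pA) / pA} = 0 := by
  have := hμ.isProbabilityMeasure
  have hR := hμ.restrict_Ioi hp
  set r := (1 - pA) / pA with hr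
  have hr0 : 0 < r := hp.fixedPoint_pos
  have hg := hp.g_pos
  by_contra hne
  set K : ℝ≥0∞ := ENNReal.ofReal (pB / g) * (ENNReal.ofReal r * μ {r}) * ENNReal.ofReal pA⁻¹ with hK
  have hK0 : K ≠ 0 := by
    have h1 : ENNReal.ofReal (pB / g) ≠ 0 := by simpa using div_pos hp.pB_pos hg
    have h2 : ENNReal.ofReal r ≠ 0 := by simpa using hr0
    have h3 : ENNReal.ofReal pA⁻¹ ≠ 0 := by simpa using hp.pA_pos
    exact mul_ne_zero (mul_ne_zero h1 (mul_ne_zero h2 hne)) h3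
  have hN : ∀ x ∈ Set.Ioc r (r + g), ENNReal.ofReal r * μ {r} ≤ windowMoment g μ x := by
    intro x hx
    have h1 : ({r} : Set ℝ) ⊆ Set.Icc (x - g) x :=
      Set.singleton_subset_iff.mpr ⟨by linarith [hx.2], hx.1.le⟩
    calc ENNReal.ofReal r * μ {r} = ∫⁻ z in {r}, ENNReal.ofReal z ∂μ := by
          rw [lintegral_singleton]
      _ ≤ _ := lintegral_mono_set h1
  have hInf : ∫⁻ x in Set.Ioc r (r + g), ENNReal.ofReal ((x - r)⁻¹) = ⊤ := by
    by_contra hfin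
    have h1 : IntervalIntegrable (fun x => (x - r)⁻¹) volume r (r + g) := by
      rw [intervalIntegrable_iff_integrableOn_Ioc_of_le (by linarith)]
      refine ⟨by fun_prop, ?_⟩
      rw [hasFiniteIntegral_iff_ofReal]
      · exact lt_top_iff_ne_top.mpr hfin
      · filter_upwards [ae_restrict_mem measurableSet_Ioc] with x hx
        exact inv_nonneg.mpr (by linarith [hx.1])
    rw [intervalIntegrable_sub_inv_iff] at h1
    rcases h1 with h1 | h1
    · linarith
    · exact h1 Set.left_mem_uIcc
  have h2 : μ (Set.Ioc r (r + g)) = ⊤ := by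
    have h3 : μ (Set.Ioc r (r + g)) = μ.restrict (Set.Ioi r) (Set.Ioc r (r + g)) := by
      rw [Measure.restrict_apply measurableSet_Ioc,
        Set.inter_eq_left.mpr Set.Ioc_subset_Ioi_self]
    rw [h3, hR, withDensity_apply _ measurableSet_Ioc, Measure.restrict_restrict measurableSet_Ioc,
      Set.inter_eq_left.mpr Set.Ioc_subset_Ioi_self]
    refine top_le_iff.mp ?_
    calc (⊤ : ℝ≥0∞) = K * ∫⁻ x in Set.Ioc r (r + g), ENNReal.ofReal ((x - r)⁻¹) := by
          rw [hInf, ENNReal.mul_top hK0]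
      _ = ∫⁻ x in Set.Ioc r (r + g), K * ENNReal.ofReal ((x - r)⁻¹) := by
          rw [lintegral_const_mul _ (by fun_prop)]
      _ ≤ _ := by
          refine setLIntegral_mono' measurableSet_Ioc fun x hx => ?_
          have hx0 : 0 < x - r := by linarith [hx.1]
          rw [← ENNReal.ofReal_inv_of_pos (mul_pos hp.pA_pos hx0), mul_inv,
            ENNReal.ofReal_mul (inv_nonneg.mpr hp.pA_pos.le), hK, mul_assoc]
          gcongr
          exact hN x hx
  exact measure_ne_top μ _ h2

/-- A solution of the flux equation between measures has a density solving the pointwise flux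
equation. -/
lemma IsFluxMeasure.exists_density : ∃ φ : ℝ → ℝ,
    μ = volume.withDensity (fun x => ENNReal.ofReal (φ x)) ∧
    IsFluxSolution ((1 - pA) / pA) g (pB / g / pA) φ ∧ ∃ x, φ x ≠ 0 := by
  have := hμ.isProbabilityMeasure
  have hR := hμ.restrict_Ioi hp
  have h0 := hμ.measure_Iio hp
  have h1 := hμ.measure_singleton hp
  set r := (1 - pA) / pA with hr
  have hr0 : 0 < r := hp.fixedPoint_pos
  have hg := hp.g_pos
  have hA := hp.pA_pos
  have hB := hp.pB_pos
  have hNm := measurable_windowMoment g μ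
  have hNtop : ∀ x, windowMoment g μ x ≠ ⊤ := fun x => hμ.lintegral_ne_top _
  set φ : ℝ → ℝ := fun x => if x ≤ r then 0 else
    pB / g / pA * (windowMoment g μ x).toReal / (x - r) with hφ
  have hφnn : ∀ x, 0 ≤ φ x := fun x => by
    simp only [hφ]
    split_ifs with h
    · exact le_rfl
    · exact div_nonneg (mul_nonneg (by positivity) ENNReal.toReal_nonneg) (by linarith)
  have hφm : Measurable φ :=
    Measurable.ite measurableSet_Iic measurable_const (by fun_prop)
  have hae : ∀ᵐ x ∂μ, x ∈ Set.Ioi r := by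
    rw [ae_iff]
    have : {a | a ∉ Set.Ioi r} = Set.Iio r ∪ {r} := by
      ext x
      simp [le_iff_lt_or_eq]
    rw [this]
    exact measure_union_null h0 h1
  have hdens : μ = volume.withDensity (fun x => ENNReal.ofReal (φ x)) := by
    rw [← Measure.restrict_eq_self_of_ae_mem hae, hR, ← withDensity_indicator measurableSet_Ioi]
    congr 1
    ext x
    rcases le_or_gt x r with h | h
    · rw [Set.indicator_of_notMem (by simpa using h)]
      simp [hφ, h]
    · rw [Set.indicator_of_mem (by exact h)]
      have hx : 0 < x - r := sub_pos.mpr h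
      simp only [hφ, not_le.mpr h, if_false]
      rw [← ENNReal.ofReal_inv_of_pos (mul_pos hA hx)]
      nth_rewrite 1 [← ENNReal.ofReal_toReal (hNtop x)]
      rw [← ENNReal.ofReal_mul (by positivity), ← ENNReal.ofReal_mul (by positivity)]
      congr 1
      field_simp
  have hnn : ∀ z, 0 ≤ z * φ z := fun z => by
    rcases le_or_gt z r with h | h
    · simp [hφ, h]
    · exact mul_nonneg (hr0.trans h).le (hφnn z)
  -- moments of `μ` in terms of the density
  have hmom : ∀ A, MeasurableSet A → ∫⁻ z in A, ENNReal.ofReal z ∂μ =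
      ∫⁻ z in A, ENNReal.ofReal (z * φ z) := by
    intro A hAm
    rw [hdens, restrict_withDensity hAm, lintegral_withDensity_eq_lintegral_mul _ (by fun_prop)
      (by fun_prop)]
    refine lintegral_congr fun z => ?_
    simp only [Pi.mul_apply]
    rw [← ENNReal.ofReal_mul (hφnn z), mul_comm]
  have hint : Integrable fun z => z * φ z := by
    refine ⟨(measurable_id.mul hφm).aestronglyMeasurable, ?_⟩
    rw [hasFiniteIntegral_iff_ofReal (ae_of_all _ hnn)]
    have h2 := hmom Set.univ MeasurableSet.univ
    simp only [Measure.restrict_univ] at h2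
    rw [← h2]
    exact lt_top_iff_ne_top.mpr hμ.finite_mean
  refine ⟨φ, hdens, ⟨hφnn, fun x hx => by simp [hφ, hx], fun x hx => ?_, hint⟩, ?_⟩
  · have h2 : (windowMoment g μ x).toReal = ∫ z in (x - g)..x, z * φ z := by
      rw [windowMoment, hmom _ measurableSet_Icc, intervalIntegral.integral_of_le (by linarith),
        ← integral_Icc_eq_integral_Ioc, integral_eq_lintegral_of_nonneg_ae (ae_of_all _ hnn)
        hint.aestronglyMeasurable.restrict]
    rw [← h2]
    simp only [hφ, not_le.mpr hx, if_false]
  · by_contra! hall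
    have h2 : μ Set.univ = 0 := by
      rw [hdens]
      simp [hall]
    simp at h2

end

/-! ### The flux equation for the stationary distribution -/

section
variable {pA pB g : ℝ} (hp : Admissible pA pB g) {ν : Measure ℝ≥0} [IsProbabilityMeasure ν]
  (hν : ∀ θ : ℝ, 0 < θ →
    ∫ z : ℝ≥0, Real.exp (-(θ * z)) ∂ν = Real.exp (-(immigration pA pB g θ)))
include hp hν

/-- The derivative of the Laplace transform `exp (-B)`. -/
lemma integral_mul_exp_of_laplace_eq {θ : ℝ} (hθ : 0 < θ) :
    ∫ z : ℝ≥0, (z : ℝ) * Real.exp (-(θ * z)) ∂ν =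
      (1 - pA) * (θ / branching pA pB g θ) * Real.exp (-(immigration pA pB g θ)) := by
  have hset : Set.Iio (0 : ℝ) ⊆ integrableExpSet (fun z : ℝ≥0 => (z : ℝ)) ν := by
    intro s hs
    have := integrable_exp_neg_mul ν (θ := -s) (by linarith [Set.mem_Iio.mp hs])
    simpa [integrableExpSet] using this
  have hint : -θ ∈ interior (integrableExpSet (fun z : ℝ≥0 => (z : ℝ)) ν) :=
    interior_mono hset (by rw [interior_Iio]; simpa using hθ)
  have h1 := hasDerivAt_mgf hint
  have h2 : mgf (fun z : ℝ≥0 => (z : ℝ)) ν =ᶠ[𝓝 (-θ)]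
      fun s => Real.exp (-(immigration pA pB g (-s))) := by
    filter_upwards [Iio_mem_nhds (by linarith : -θ < 0)] with s hs
    rw [← hν (-s) (by linarith [Set.mem_Iio.mp hs]), mgf]
    simp
  have h3 : HasDerivAt (fun s => Real.exp (-(immigration pA pB g (-s))))
      (Real.exp (-(immigration pA pB g (- -θ))) *
        -((1 - pA) * (- -θ / branching pA pB g (- -θ)) * -1)) (-θ) := by
    have h4 := hasDerivAt_immigration hp (by linarith : 0 < - -θ)
    exact ((h4.comp (-θ) (hasDerivAt_neg (-θ))).neg).exp
  have h5 := (h1.congr_of_eventuallyEq h2.symm).unique h3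
  rw [neg_neg] at h5
  simp only [neg_mul] at h5
  rw [h5]
  ring

omit hp hν in
lemma integrable_mul_exp {θ : ℝ} (hθ : 0 < θ) :
    Integrable (fun z : ℝ≥0 => (z : ℝ) * Real.exp (-(θ * z))) ν := by
  refine Integrable.of_bound (by fun_prop) (1 / θ) (ae_of_all _ fun z => ?_)
  rw [Real.norm_of_nonneg (mul_nonneg z.coe_nonneg (Real.exp_pos _).le), Real.exp_neg,
    ← div_eq_mul_inv, div_le_div_iff₀ (Real.exp_pos _) hθ, one_mul, mul_comm]
  linarith [Real.add_one_le_exp (θ * z)]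

lemma lintegral_coe_ne_top : ∫⁻ z : ℝ≥0, (z : ℝ≥0∞) ∂ν ≠ ⊤ := by
  set θ : ℕ → ℝ := fun n => 1 / ((n : ℝ) + 1) with hθ
  have hθ0 : ∀ n, 0 < θ n := fun n => by positivity
  have h1 : ∀ n, ∫⁻ z : ℝ≥0, ENNReal.ofReal ((z : ℝ) * Real.exp (-(θ n * z))) ∂ν ≤
      ENNReal.ofReal ((1 - pA) * (1 / (pA - pB))) := by
    intro n
    rw [← ofReal_integral_eq_lintegral_ofReal (integrable_mul_exp (hθ0 n))
      (ae_of_all _ fun z => mul_nonneg z.coe_nonneg (Real.exp_pos _).le),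
      integral_mul_exp_of_laplace_eq hp hν (hθ0 n)]
    refine ENNReal.ofReal_le_ofReal ?_
    have h2 : Real.exp (-(immigration pA pB g (θ n))) ≤ 1 :=
      Real.exp_le_one_iff.mpr (by linarith [immigration_nonneg hp (hθ0 n).le])
    have h3 : 0 ≤ (1 - pA) * (θ n / branching pA pB g (θ n)) :=
      mul_nonneg (by linarith [hp.lt_one]) (div_nonneg (hθ0 n).le (branching_pos hp (hθ0 n)).le)
    refine (mul_le_of_le_one_right h3 h2).trans ?_
    exact mul_le_mul_of_nonneg_left (div_branching_le hp (hθ0 n)) (by linarith [hp.lt_one])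
  have h2 : ∀ z : ℝ≥0, liminf (fun n => ENNReal.ofReal ((z : ℝ) * Real.exp (-(θ n * z)))) atTop =
      (z : ℝ≥0∞) := by
    intro z
    refine Tendsto.liminf_eq ?_
    have h3 : Tendsto θ atTop (𝓝 0) := tendsto_one_div_add_atTop_nhds_zero_nat
    have h4 : Continuous fun s : ℝ => ENNReal.ofReal ((z : ℝ) * Real.exp (-(s * z))) :=
      ENNReal.continuous_ofReal.comp (by fun_prop)
    have h5 := (h4.tendsto 0).comp h3
    simpa [Function.comp_def] using h5
  have h3 := lintegral_liminf_le (μ := ν) (u := atTop)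
    (f := fun n (z : ℝ≥0) => ENNReal.ofReal ((z : ℝ) * Real.exp (-(θ n * z)))) (fun n => by fun_prop)
  simp_rw [h2] at h3
  refine ne_top_of_le_ne_top (ENNReal.ofReal_ne_top (r := (1 - pA) * (1 / (pA - pB)))) (h3.trans ?_)
  exact liminf_le_of_le (by isBoundedDefault) fun b hb => by
    obtain ⟨n, hn⟩ := hb.exists
    exact hn.trans (h1 n)

omit hp hν [IsProbabilityMeasure ν] in
/-- Convolution of a measure on `[0, ∞)` with the uniform measure on `[0, g]`. -/
noncomputable def convUniform (g : ℝ) (m : Measure ℝ≥0) : Measure ℝ≥0 :=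
  (m.prod (volume.restrict (Set.Icc (0 : ℝ) g))).map fun q => q.1 + q.2.toNNReal

omit hp hν [IsProbabilityMeasure ν] in
lemma integral_exp_convUniform (m : Measure ℝ≥0) [IsFiniteMeasure m] {θ : ℝ} (hθ : 0 < θ)
    (hg : 0 < g) : ∫ z : ℝ≥0, Real.exp (-(θ * z)) ∂(convUniform g m) =
      (∫ z : ℝ≥0, Real.exp (-(θ * z)) ∂m) * ((1 - Real.exp (-(g * θ))) / θ) := by
  have h1 : ∫ s in Set.Icc (0 : ℝ) g, Real.exp (-(θ * s.toNNReal)) =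
      (1 - Real.exp (-(g * θ))) / θ := by
    have h2 : ∫ s in Set.Icc (0 : ℝ) g, Real.exp (-(θ * s.toNNReal)) =
        ∫ s in Set.Icc (0 : ℝ) g, Real.exp (-(θ * s)) := by
      refine setIntegral_congr_fun measurableSet_Icc fun s hs => ?_
      rw [Real.coe_toNNReal _ hs.1]
    rw [h2, integral_Icc_eq_integral_Ioc, ← intervalIntegral.integral_of_le hg.le]
    have h3 : ∀ s ∈ Set.uIcc 0 g, HasDerivAt (fun s => -(Real.exp (-(θ * s)) / θ))
        (Real.exp (-(θ * s))) s := fun s _ => by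
      refine ((hasDerivAt_exp_neg_mul θ s).div_const θ).neg.congr_deriv ?_
      field_simp
    rw [intervalIntegral.integral_eq_sub_of_hasDerivAt h3
      ((by fun_prop : Continuous fun s : ℝ => Real.exp (-(θ * s))).intervalIntegrable _ _)]
    rw [mul_zero, neg_zero, Real.exp_zero, mul_comm θ g]
    ring
  rw [convUniform, integral_map (by fun_prop) (by fun_prop), ← h1,
    ← integral_prod_mul (fun z : ℝ≥0 => Real.exp (-(θ * z)))
      (fun s : ℝ => Real.exp (-(θ * s.toNNReal)))]
  refine integral_congr_ae (ae_of_all _ fun q => ?_)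
  simp only
  rw [← Real.exp_add, NNReal.coe_add]
  congr 1
  ring

omit hp hν [IsProbabilityMeasure ν] in
lemma convUniform_preimage (m : Measure ℝ≥0) [IsFiniteMeasure m] {A : Set ℝ}
    (hA : MeasurableSet A) (g : ℝ) : convUniform g m ((↑) ⁻¹' A) =
      ∫⁻ x in A, m {z : ℝ≥0 | (z : ℝ) ∈ Set.Icc (x - g) x} := by
  have hA' : MeasurableSet ((↑) ⁻¹' A : Set ℝ≥0) := measurable_subtype_coe hA
  set S : Set (ℝ≥0 × ℝ) := {q | (q.1 : ℝ) ∈ Set.Icc (q.2 - g) q.2} with hS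
  have hs : MeasurableSet S := by
    have h1 : MeasurableSet {q : ℝ≥0 × ℝ | q.2 - g ≤ (q.1 : ℝ)} :=
      measurableSet_le (by fun_prop) (by fun_prop)
    have h2 : MeasurableSet {q : ℝ≥0 × ℝ | (q.1 : ℝ) ≤ q.2} :=
      measurableSet_le (by fun_prop) measurable_snd
    exact h1.inter h2
  set J : ℝ≥0 × ℝ → ℝ≥0∞ := S.indicator fun _ => 1 with hJ
  have hJm : Measurable J := measurable_const.indicator hs
  have hm : Measurable fun q : ℝ≥0 × ℝ => q.1 + q.2.toNNReal := by fun_prop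
  -- for fixed `z`, shift the variable `s ∈ [0, g]` by `z`
  have h1 : ∀ z : ℝ≥0, (volume.restrict (Set.Icc (0 : ℝ) g))
      (Prod.mk z ⁻¹' ((fun q : ℝ≥0 × ℝ => q.1 + q.2.toNNReal) ⁻¹' ((↑) ⁻¹' A))) =
      ∫⁻ x in A, J (z, x) := by
    intro z
    have h2 : ∫⁻ x in A, J (z, x) = ∫⁻ s, A.indicator (fun x => J (z, x)) (s + z) := by
      rw [lintegral_add_right_eq_self (fun x => A.indicator (fun x => J (z, x)) x),
        lintegral_indicator hA]
    rw [h2, ← lintegral_indicator_one (measurable_prodMk_left (hm hA')), ← lintegral_indicator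
      measurableSet_Icc]
    refine lintegral_congr fun s => ?_
    by_cases hs0 : s ∈ Set.Icc (0 : ℝ) g
    · have h3 : J (z, s + z) = 1 :=
        Set.indicator_of_mem (s := S) (a := (z, s + z))
          ⟨by simp only; linarith [hs0.2], by simp only; linarith [hs0.1]⟩ _
      rw [Set.indicator_of_mem hs0]
      by_cases hsA : s + (z : ℝ) ∈ A
      · rw [Set.indicator_of_mem hsA, h3, Set.indicator_of_mem]
        · rfl
        · simpa [Real.coe_toNNReal _ hs0.1, add_comm] using hsA
      · rw [Set.indicator_of_notMem hsA, Set.indicator_of_notMem]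
        simpa [Real.coe_toNNReal _ hs0.1, add_comm] using hsA
    · have h3 : J (z, s + z) = 0 := Set.indicator_of_notMem (s := S) (a := (z, s + z)) (fun h =>
        hs0 ⟨by have := h.2; simp only at this; linarith,
          by have := h.1; simp only at this; linarith⟩) _
      rw [Set.indicator_of_notMem hs0]
      by_cases hsA : s + (z : ℝ) ∈ A
      · rw [Set.indicator_of_mem hsA, h3]
      · rw [Set.indicator_of_notMem hsA]
  rw [convUniform, Measure.map_apply hm hA', Measure.prod_apply (hm hA'), lintegral_congr h1,
    lintegral_lintegral_swap (f := fun z x => J (z, x)) hJm.aemeasurable]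
  refine setLIntegral_congr_fun hA fun x _ => ?_
  have h4 : MeasurableSet {z : ℝ≥0 | (z : ℝ) ∈ Set.Icc (x - g) x} :=
    measurable_subtype_coe measurableSet_Icc
  rw [← lintegral_indicator_one h4]
  rfl

/-- The identity `R(θ) ∫ z exp (-θ z) dν = (1 - pA) θ ∫ exp (-θ z) dν` between Laplace transforms,
divided by `θ` and inverted. -/
lemma isFluxMeasure_of_laplace_eq : IsFluxMeasure pA pB g (ν.map ((↑) : ℝ≥0 → ℝ)) := by
  have hcoe : Measurable ((↑) : ℝ≥0 → ℝ) := measurable_subtype_coe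
  have hg := hp.g_pos
  have hA0 := hp.pA_pos
  have hB0 := hp.pB_pos
  have hmean := lintegral_coe_ne_top hp hν
  set m : Measure ℝ≥0 := ν.withDensity fun z => (z : ℝ≥0∞) with hm
  have hmfin : IsFiniteMeasure m := isFiniteMeasure_withDensity hmean
  have hconvfin : IsFiniteMeasure (convUniform g m) := by
    unfold convUniform
    infer_instance
  have hmap : ∀ A, MeasurableSet A → ∫⁻ z in A, ENNReal.ofReal z ∂(ν.map ((↑) : ℝ≥0 → ℝ)) =
      m ((↑) ⁻¹' A) := by
    intro A hA
    rw [setLIntegral_map hA (by fun_prop) hcoe, hm, withDensity_apply _ (hcoe hA)]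
    simp
  have heq : ENNReal.ofReal pA • m = ENNReal.ofReal (1 - pA) • ν +
      ENNReal.ofReal (pB / g) • convUniform g m := by
    have f1 : IsFiniteMeasure (ENNReal.ofReal pA • m) := Measure.smul_finite m ENNReal.ofReal_ne_top
    have f2 : IsFiniteMeasure (ENNReal.ofReal (1 - pA) • ν) :=
      Measure.smul_finite ν ENNReal.ofReal_ne_top
    have f3 : IsFiniteMeasure (ENNReal.ofReal (pB / g) • convUniform g m) :=
      Measure.smul_finite _ ENNReal.ofReal_ne_top
    refine ext_of_laplace fun θ hθ => ?_
    rw [integral_add_measure (integrable_exp_neg_mul _ hθ.le) (integrable_exp_neg_mul _ hθ.le),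
      integral_smul_measure, integral_smul_measure, integral_smul_measure,
      integral_exp_convUniform m hθ hg, hν θ hθ, ENNReal.toReal_ofReal hA0.le,
      ENNReal.toReal_ofReal (by linarith [hp.lt_one]), ENNReal.toReal_ofReal (by positivity)]
    have h1 : ∫ z : ℝ≥0, Real.exp (-(θ * z)) ∂m =
        (1 - pA) * (θ / branching pA pB g θ) * Real.exp (-(immigration pA pB g θ)) := by
      rw [← integral_mul_exp_of_laplace_eq hp hν hθ, hm,
        integral_withDensity_eq_integral_smul (f := fun z : ℝ≥0 => z) measurable_id]
      rfl
    have hR := (branching_pos hp hθ).ne'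
    have hR' : pA * θ - pB / g * (1 - Real.exp (-(g * θ))) = branching pA pB g θ := rfl
    rw [h1]
    simp only [smul_eq_mul]
    have h2 : pA - pB / g * ((1 - Real.exp (-(g * θ))) / θ) = branching pA pB g θ / θ := by
      rw [← hR']
      field_simp
    have h3 : branching pA pB g θ / θ * (θ / branching pA pB g θ) = 1 := by field_simp
    linear_combination ((1 - pA) * (θ / branching pA pB g θ) *
      Real.exp (-(immigration pA pB g θ))) * h2 +
      (1 - pA) * Real.exp (-(immigration pA pB g θ)) * h3
  refine ⟨Measure.isProbabilityMeasure_map hcoe.aemeasurable, ?_, ?_, fun A hA => ?_⟩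
  · rw [Measure.map_apply hcoe measurableSet_Iio]
    have : ((↑) : ℝ≥0 → ℝ) ⁻¹' Set.Iio 0 = ∅ := by
      ext z
      simp
    rw [this, measure_empty]
  · have := hmap Set.univ MeasurableSet.univ
    rw [Measure.restrict_univ] at this
    rw [this]
    exact measure_ne_top m _
  · have h1 := congrArg (fun M : Measure ℝ≥0 => M ((↑) ⁻¹' A)) heq
    simp only [Measure.smul_apply, Measure.add_apply, smul_eq_mul] at h1
    rw [hmap A hA, h1, Measure.map_apply hcoe hA, convUniform_preimage m hA]
    congr 2
    refine lintegral_congr fun x => ?_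
    rw [windowMoment, hmap _ measurableSet_Icc]
    rfl

end

end Bandit

theorem mainTheorem2 (pA pB g : ℝ) (hpB : 0 < pB) (hpAB : pB < pA) (hpA : pA < 1) (hg : 0 < g) :
    (∃! P : ℝ≥0 → Kernel ℝ≥0 ℝ≥0, Bandit.IsMarkovSemigroupWithGeneratorL pA pB g P) ∧
    ∀ P : ℝ≥0 → Kernel ℝ≥0 ℝ≥0, Bandit.IsMarkovSemigroupWithGeneratorL pA pB g P →
      ∃ ν : Measure ℝ≥0,
        Bandit.IsStationary P ν ∧
        (∀ ν' : Measure ℝ≥0, Bandit.IsStationary P ν' → ν' = ν) ∧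
        (∀ K : Set ℝ≥0, IsCompact K → ∀ f : ℝ≥0 →ᵇ ℝ,
          TendstoUniformlyOn (fun (t : ℝ≥0) (y : ℝ≥0) => ∫ z, f z ∂(P t y))
            (fun _ => ∫ z, f z ∂ν) atTop K) ∧
        ∃ φ : ℝ → ℝ,
          ν.map ((↑) : ℝ≥0 → ℝ) = volume.withDensity (fun x => ENNReal.ofReal (φ x)) ∧
          (∀ x ≤ (1 - pA) / pA, φ x = 0) ∧
          (∀ x, (1 - pA) / pA < x → 0 < φ x) ∧
          ContinuousOn φ (Set.Ioi ((1 - pA) / pA)) ∧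
          ContDiffOn ℝ ∞ φ {x : ℝ | ∀ n : ℕ, x ≠ (1 - pA) / pA + g * n} := by
  have hp : Bandit.Admissible pA pB g := ⟨hpB, hpAB, hpA, hg⟩
  refine ⟨⟨Bandit.transition pA pB g, Bandit.isMarkovSemigroupWithGeneratorL_transition hp,
    fun Q hQ => hQ.unique hp (Bandit.isMarkovSemigroupWithGeneratorL_transition hp)⟩,
    fun P hP => ?_⟩
  obtain ⟨ν, hν⟩ := Bandit.exists_laplace_eq_exp_neg_immigration hp hP
  have hst : Bandit.IsStationary P ν := Bandit.isStationary_of_laplace_eq hp hP hν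
  obtain ⟨φ, hdens, hφ, hne⟩ := (Bandit.isFluxMeasure_of_laplace_eq hp hν).exists_density hp
  have hκ : 0 < pB / g / pA := div_pos (div_pos hpB hg) hp.pA_pos
  refine ⟨ν, hst, fun ν' hν' => ?_, fun K hK f =>
    Bandit.tendstoUniformlyOn_of_isStationary hp hP hst hK f, φ, hdens, hφ.eq_zero,
    fun x hx => hφ.pos hp.fixedPoint_pos hg hκ hne hx, hφ.continuousOn, hφ.contDiffOn hg.ne'⟩
  have := hν'.1
  exact Bandit.ext_of_laplace fun θ hθ => by rw [hν'.laplace_eq hp hP hθ, hν θ hθ]
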